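/- Let $n\in\mathbb N$ and $p\in(1,n]$. For $x_0\in\mathbb R^n$ and $i\ge 1$ put $$\omega_i(x_0)=\{x: 2^{-i}\le|x-x_0|\le 2^{-i+1}\},\qquad \Omega_i(x_0)=\{x: 2^{-i-1}<|x-x_0|<2^{-i+2}\}.$$ For a compact subset $K$ of an open set $\Omega\subset\mathbb R^n$ let $$cap_p(K,\Omega)=\inf\Big\{\int_\Omega|\nabla u|^p\,dx:\ u\in C_0^\infty(\Omega),\ u\ge 1\text{ on }K\Big\},$$ and for an arbitrary subset $E\subset\Omega$ let $$cap_p(E,\Omega)=\inf_{G\text{ open},\,E\subset G\subset\Omega}\ \ \sup_{K\text{ compact},\,K\subset G}cap_p(K,\Omega)$$ (for compact $E$ the two definitions agree). A set $E\subset\mathbb R^n$ is called $p$-thin for singular behavior at $x_0$ if $$\sum_{i=1}^\infty\frac{cap_p(E\cap\omega_i(x_0),\Omega_i(x_0))}{cap_p(\partial B(x_0,2^{-i}),B(x_0,2^{-i+1}))}<\infty\quad\text{when }p<n,$$ $$\sum_{i=1}^\infty i^{\,n-1}\,cap_n(E\cap\omega_i(x_0),\Omega_i(x_0))<\infty\quad\text{when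 }p=n.$$ For a nonnegative Radon measure $\mu$ the Wolff potential is $$W^\mu_{1,p}(x,r)=\int_0^r\Big(\frac{\mu(B(x,t))}{t^{n-p}}\Big)^{\frac1{p-1}}\frac{dt}{t}\in[0,\infty].$$ **Theorem.** Let $E\subset\mathbb R^n$ be $p$-thin for singular behavior at the origin, and suppose that $0\in\overline E\setminus E$. If $p\in(1,n)$, then there are an open neighborhood $U$ of the origin, a nonnegative Radon measure $\mu$ on $\mathbb R^n$ with $\mu(\mathbb R^n\setminus U)=0$, and an $r_0>0$ with $B(0,2r_0)\subset U$, such that $$\lim_{x\to0,\ x\in E}|x|^{\frac{n-p}{p-1}}\,W^\mu_{1,p}(x,r_0)=\infty.$$ If $p=n$, then there are such $U$, $\mu$ and $r_0$ with $$\lim_{x\to0,\ x\in E}\frac{W^\mu_{1,n}(x,r_0)}{\log\frac1{|x|}}=\infty.$$ -/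

import Mathlib

open MeasureTheory Set Filter Topology
open scoped ENNReal ContDiff

noncomputable section

/-- The closed dyadic annulus `ω_i(x₀) = {x : 2^{-i} ≤ |x - x₀| ≤ 2^{-i+1}}`. -/
def closedAnnulus {n : ℕ} (x₀ : EuclideanSpace ℝ (Fin n)) (i : ℕ) :
    Set (EuclideanSpace ℝ (Fin n)) :=
  {x | (2 : ℝ) ^ (-(i : ℤ)) ≤ ‖x - x₀‖ ∧ ‖x - x₀‖ ≤ (2 : ℝ) ^ (-(i : ℤ) + 1)}

/-- The open annulus `Ω_i(x₀) = {x : 2^{-i-1} < |x - x₀| < 2^{-i+2}}`, a domain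
containing `ω_i(x₀)`. -/
def openAnnulus {n : ℕ} (x₀ : EuclideanSpace ℝ (Fin n)) (i : ℕ) :
    Set (EuclideanSpace ℝ (Fin n)) :=
  {x | (2 : ℝ) ^ (-(i : ℤ) - 1) < ‖x - x₀‖ ∧ ‖x - x₀‖ < (2 : ℝ) ^ (-(i : ℤ) + 2)}

/-- Admissible functions for the capacity of `K` in `Ω`: functions `u ∈ C₀^∞(Ω)` (smooth,
with compact support contained in `Ω`) with `u ≥ 1` on `K`. -/
structure IsCapAdmissible {n : ℕ} (K Ω : Set (EuclideanSpace ℝ (Fin n)))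
    (u : EuclideanSpace ℝ (Fin n) → ℝ) : Prop where
  smooth : ContDiff ℝ ∞ u
  compactSupport : HasCompactSupport u
  support_subset : tsupport u ⊆ Ω
  one_le : ∀ x ∈ K, 1 ≤ u x

/-- The `p`-energy `∫_Ω |∇u|^p dx`; the operator norm of the differential is the Euclidean
norm of the gradient. -/
def pEnergy {n : ℕ} (p : ℝ) (Ω : Set (EuclideanSpace ℝ (Fin n)))
    (u : EuclideanSpace ℝ (Fin n) → ℝ) : ℝ≥0∞ :=
  ∫⁻ x in Ω, ‖fderiv ℝ u x‖ₑ ^ p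

/-- The variational `p`-capacity `cap_p(K, Ω)` of a compact subset `K` of `Ω`. -/
def pCapCompact {n : ℕ} (p : ℝ) (K Ω : Set (EuclideanSpace ℝ (Fin n))) : ℝ≥0∞ :=
  ⨅ (u : EuclideanSpace ℝ (Fin n) → ℝ) (_ : IsCapAdmissible K Ω u), pEnergy p Ω u

/-- The `p`-capacity `cap_p(E, Ω)` of an arbitrary subset `E` of `Ω`: the infimum, over the
open `G` with `E ⊆ G ⊆ Ω`, of the supremum of `cap_p(K, Ω)` over the compact `K ⊆ G`. -/
def pCap {n : ℕ} (p : ℝ) (E Ω : Set (EuclideanSpace ℝ (Fin n))) : ℝ≥0∞ :=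
  ⨅ (G : Set (EuclideanSpace ℝ (Fin n))) (_ : IsOpen G ∧ E ⊆ G ∧ G ⊆ Ω),
    ⨆ (K : Set (EuclideanSpace ℝ (Fin n))) (_ : IsCompact K ∧ K ⊆ G), pCapCompact p K Ω

/-- For compact subsets of an open set the two definitions of the capacity agree. -/
theorem pCap_eq_pCapCompact {n : ℕ} {p : ℝ} (hp : 0 ≤ p)
    {K Ω : Set (EuclideanSpace ℝ (Fin n))} (hK : IsCompact K) (hΩ : IsOpen Ω) (hKΩ : K ⊆ Ω) :
    pCap p K Ω = pCapCompact p K Ω := by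
  apply le_antisymm
  · refine le_iInf₂ fun u hu => ?_
    have key : ∀ c : ℝ, 1 < c → pCap p K Ω ≤ ENNReal.ofReal (c ^ p) * pEnergy p Ω u := by
      intro c hc
      have hc0 : 0 < c := by linarith
      have hG : IsOpen (Ω ∩ {x | 1 / c < u x}) :=
        hΩ.inter (isOpen_lt continuous_const hu.smooth.continuous)
      have hsub : K ⊆ Ω ∩ {x | 1 / c < u x} := by
        intro x hx
        have h2 : 1 / c < 1 := by rw [div_lt_one hc0]; exact hc
        exact ⟨hKΩ hx, lt_of_lt_of_le h2 (hu.one_le x hx)⟩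
      refine (iInf₂_le (Ω ∩ {x | 1 / c < u x}) ⟨hG, hsub, inter_subset_left⟩).trans ?_
      · refine iSup₂_le fun K' hK' => ?_
        refine (iInf₂_le (fun x => c * u x) ?_).trans ?_
        · refine ⟨contDiff_const.mul hu.smooth, hu.compactSupport.mul_left,
            (closure_mono (Function.support_mul_subset_right _ _)).trans hu.support_subset, ?_⟩
          intro x hx
          have h1 : 1 / c < u x := (hK'.2 hx).2
          rw [div_lt_iff₀ hc0] at h1
          linarith
        · unfold pEnergy
          rw [← lintegral_const_mul' _ _ ENNReal.ofReal_ne_top]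
          refine lintegral_mono fun x => le_of_eq ?_
          have hd : fderiv ℝ (fun x => c * u x) x = c • fderiv ℝ u x :=
            fderiv_const_mul (hu.smooth.differentiable (by simp) x) c
          simp only [hd, enorm_smul]
          rw [ENNReal.mul_rpow_of_nonneg _ _ hp, Real.enorm_eq_ofReal hc0.le,
            ENNReal.ofReal_rpow_of_nonneg hc0.le hp]
    have hlim : Tendsto (fun c : ℝ => ENNReal.ofReal (c ^ p) * pEnergy p Ω u) (𝓝[>] 1)
        (𝓝 (ENNReal.ofReal ((1 : ℝ) ^ p) * pEnergy p Ω u)) := by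
      refine ENNReal.Tendsto.mul_const ?_ (Or.inl (by simp))
      refine (ENNReal.continuous_ofReal.tendsto _).comp ?_
      exact ((Real.continuousAt_rpow_const 1 p (Or.inl one_ne_zero)).tendsto).mono_left
        nhdsWithin_le_nhds
    have := ge_of_tendsto hlim (eventually_nhdsWithin_of_forall fun c hc => key c hc)
    simpa using this
  · refine le_iInf₂ fun G hG => ?_
    exact le_iSup₂_of_le K ⟨hK, hG.2.1⟩ le_rfl

/-- `E` is `p`-thin for singular behavior at `x₀`, for `1 < p ≤ n`. The sums run over the
integers `i ≥ 1`, written as `i + 1` with `i : ℕ`. -/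
def IsPThin {n : ℕ} (p : ℝ) (E : Set (EuclideanSpace ℝ (Fin n)))
    (x₀ : EuclideanSpace ℝ (Fin n)) : Prop :=
  (p < n →
    ∑' i : ℕ, pCap p (E ∩ closedAnnulus x₀ (i + 1)) (openAnnulus x₀ (i + 1)) /
      pCap p (Metric.sphere x₀ ((2 : ℝ) ^ (-((i + 1 : ℕ) : ℤ))))
        (Metric.ball x₀ ((2 : ℝ) ^ (-((i + 1 : ℕ) : ℤ) + 1))) < ⊤) ∧
  (p = n →
    ∑' i : ℕ, ((i + 1 : ℕ) : ℝ≥0∞) ^ ((n : ℝ) - 1) *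
      pCap p (E ∩ closedAnnulus x₀ (i + 1)) (openAnnulus x₀ (i + 1)) < ⊤)

/-- The Wolff potential `W^μ_{1,p}(x, r) = ∫₀^r (μ(B(x,t)) / t^{n-p})^{1/(p-1)} dt/t`,
with values in `[0, ∞]`. -/
def wolffPotential {n : ℕ} (p : ℝ) (μ : Measure (EuclideanSpace ℝ (Fin n)))
    (x : EuclideanSpace ℝ (Fin n)) (r : ℝ) : ℝ≥0∞ :=
  ∫⁻ t in Ioo 0 r,
    (μ (Metric.ball x t) / ENNReal.ofReal (t ^ ((n : ℝ) - p))) ^ (1 / (p - 1)) /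
      ENNReal.ofReal t

end

/-!
The annuli are treated one at a time, and the main point is an estimate for one annulus
that needs no partial differential equation: a set `F` of `p`-capacity less than `M` in a dyadic
annulus lies in the set where the Wolff potential of some measure of mass at most `C * M` is at
least `1 / C`, with `C` independent of the annulus (`exists_measure_of_pCap_lt`). Given this, the
measures of the annuli, multiplied by weights `a i * w i` with `a i → ∞` slowly enough, add up to a
finite measure by thinness, and on the `i`-th annulus their sum has a Wolff potential of order at
least `(a i * w i) ^ (1 / (p - 1))`. Here `w i = 2 ^ ((i + 1) * (n - p))` for `p < n` and
`w i = (i + 1) ^ (n - 1)` for `p = n`, which cancels the normalizing factor in the limit.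

For the estimate in one annulus choose an open `G ⊇ F` all of whose compact subsets carry test
functions `u` of energy at most `M`, and to finitely many points `x i ∈ G` attach the dyadic scales
down to some minimal one, `δ i`, with `closedBall (x i) (δ i) ⊆ G`.

* Minimizing a convex energy over finitely many masses gives an equilibrium: the Wolff potential,
  truncated to these scales, is at least a constant at every point; with smaller balls, and
  counting at the scale `r` only the masses with `δ i ≤ r`, it is at most `1` at the charged points
  (`exists_equilibrium_weights`, `exists_equilibrium_masses`).
* If `u ≥ 1` on the balls of minimal scale, the truncated Riesz potential of `|∇u|` is bounded below
  at each `x i` (`exists_one_le_sum_lintegral_fderiv`). Integrating this against the masses and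
  using Hölder's inequality together with Wolff's inequality for truncated potentials
  (`exists_lintegral_dyadicRiesz_rpow_le`) bounds the total mass by the energy of `u`
  (`exists_sum_le_energy`).
* A weak limit over all finite subsets of `G` yields the measure
  (`exists_measure_one_le_wolffPotential`). The truncation makes the lower bound at a given point
  involve only finitely many closed balls, hence it survives the limit, although mass may
  concentrate at small scales.
-/

/-! ### Elementary inequalities -/

/-- The tangent line inequality for the convex function `t ↦ t ^ (q + 1)`. -/
theorem rpow_sub_rpow_le_mul_sub {q a b : ℝ} (hq : 0 < q) (ha : 0 ≤ a) (hb : 0 ≤ b) :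
    b ^ (q + 1) - a ^ (q + 1) ≤ (q + 1) * b ^ q * (b - a) := by
  have hconj : ((q + 1) / q).HolderConjugate (q + 1) := by
    rw [Real.holderConjugate_iff]
    refine ⟨?_, ?_⟩
    · rw [lt_div_iff₀ hq]; linarith
    · field_simp
  -- Young's inequality for the product of `b ^ q` and `a`
  have h := Real.young_inequality_of_nonneg (Real.rpow_nonneg hb q) ha hconj
  rw [← Real.rpow_mul hb, mul_div_cancel₀ _ hq.ne'] at h
  have h1 : b ^ (q + 1) = b ^ q * b := Real.rpow_add_one' hb (by linarith)
  have h2 : (q + 1) * (b ^ q * a) ≤ q * b ^ (q + 1) + a ^ (q + 1) := by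
    calc (q + 1) * (b ^ q * a)
        ≤ (q + 1) * (b ^ (q + 1) / ((q + 1) / q) + a ^ (q + 1) / (q + 1)) := by gcongr
      _ = q * b ^ (q + 1) + a ^ (q + 1) := by field_simp
  nlinarith [h1, h2]

/-- Summation by parts: a power of a sum is controlled by the increments weighted with the
powers of the partial sums. -/
theorem rpow_sum_range_le {q : ℝ} (hq : 0 < q) (b : ℕ → ℝ) (hb : ∀ k, 0 ≤ b k) (N : ℕ) :
    (∑ k ∈ Finset.range N, b k) ^ (q + 1) ≤
      (q + 1) * ∑ k ∈ Finset.range N, b k * (∑ l ∈ Finset.range (k + 1), b l) ^ q := by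
  induction N with
  | zero => simp [Real.zero_rpow (by linarith : q + 1 ≠ 0)]
  | succ N ih =>
    have h := rpow_sub_rpow_le_mul_sub hq
      (Finset.sum_nonneg fun k (_ : k ∈ Finset.range N) => hb k)
      (Finset.sum_nonneg fun k (_ : k ∈ Finset.range (N + 1)) => hb k)
    have h2 : ∑ k ∈ Finset.range (N + 1), b k - ∑ k ∈ Finset.range N, b k = b N := by
      rw [Finset.sum_range_succ]; ring
    rw [h2] at h
    rw [Finset.sum_range_succ (fun k => b k * (∑ l ∈ Finset.range (k + 1), b l) ^ q)]
    linarith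

theorem exists_rpow_add_le {q : ℝ} (hq : 0 < q) :
    ∃ C : ℝ, 0 < C ∧ ∀ a b : ℝ, 0 ≤ a → 0 ≤ b →
      (a + b) ^ q ≤ 3 / 2 * a ^ q + C * b ^ q := by
  set θ : ℝ := (3 / 2 : ℝ) ^ (1 / q) with hθ
  have hθ1 : 1 < θ := Real.one_lt_rpow (by norm_num) (by positivity)
  have hθq : θ ^ q = 3 / 2 := by
    rw [hθ, ← Real.rpow_mul (by norm_num), one_div_mul_cancel hq.ne', Real.rpow_one]
  refine ⟨(1 / (θ - 1) + 1) ^ q, by have : 0 < θ - 1 := by linarith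
                                    positivity, fun a b ha hb => ?_⟩
  have hθ0 : 0 < θ - 1 := by linarith
  rcases le_total b ((θ - 1) * a) with h | h
  · have h1 : (a + b) ^ q ≤ (θ * a) ^ q :=
      Real.rpow_le_rpow (by positivity) (by linarith) hq.le
    rw [Real.mul_rpow (by linarith) ha, hθq] at h1
    have : 0 ≤ (1 / (θ - 1) + 1) ^ q * b ^ q := by positivity
    linarith
  · have h2 : a ≤ 1 / (θ - 1) * b := by
      rw [one_div, ← div_eq_inv_mul, le_div_iff₀ hθ0]; linarith
    have h1 : (a + b) ^ q ≤ ((1 / (θ - 1) + 1) * b) ^ q :=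
      Real.rpow_le_rpow (by positivity) (by linarith) hq.le
    rw [Real.mul_rpow (by positivity) hb] at h1
    have : 0 ≤ 3 / 2 * a ^ q := by positivity
    linarith

/-- **Hardy's inequality** with geometric weights, for every exponent `q > 0`. -/
theorem exists_hardy_geometric {q : ℝ} (hq : 0 < q) :
    ∃ C : ℝ, 0 < C ∧ ∀ (R : ℝ) (c : ℕ → ℝ), 0 ≤ R → (∀ k, 0 ≤ c k) → ∀ N : ℕ,
      ∑ k ∈ Finset.range N, R / 2 ^ k * (∑ l ∈ Finset.range (k + 1), c l) ^ q ≤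
        C * ∑ k ∈ Finset.range N, R / 2 ^ k * c k ^ q := by
  obtain ⟨C, hC, h⟩ := exists_rpow_add_le hq
  refine ⟨4 * C, by positivity, fun R c hR hc N => ?_⟩
  set S : ℕ → ℝ := fun k => ∑ l ∈ Finset.range k, c l with hS
  have hS0 : ∀ k, 0 ≤ S k := fun k => Finset.sum_nonneg fun l _ => hc l
  set X : ℕ → ℝ := fun N => ∑ k ∈ Finset.range N, R / 2 ^ k * S (k + 1) ^ q with hX
  set Y : ℕ → ℝ := fun N => ∑ k ∈ Finset.range N, R / 2 ^ k * c k ^ q with hY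
  -- splitting off the last term of each partial sum shifts the index, which gains a factor `1/2`
  have key : ∀ N, ∑ k ∈ Finset.range N, R / 2 ^ k * S k ^ q ≤ 1 / 2 * X N := by
    intro N
    cases N with
    | zero => simp [hX]
    | succ N =>
      rw [Finset.sum_range_succ']
      have h0 : S 0 ^ q = 0 := by simp [hS, Real.zero_rpow hq.ne']
      rw [h0, mul_zero, add_zero, hX]
      simp only
      rw [Finset.sum_range_succ, mul_add, Finset.mul_sum]
      have hnn : 0 ≤ 1 / 2 * (R / 2 ^ N * S (N + 1) ^ q) := by
        have := Real.rpow_nonneg (hS0 (N + 1)) q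
        positivity
      refine le_trans (le_of_eq ?_) (le_add_of_nonneg_right hnn)
      refine Finset.sum_congr rfl fun k _ => ?_
      rw [pow_succ]; field_simp
  have h1 : X N ≤ 3 / 2 * ∑ k ∈ Finset.range N, R / 2 ^ k * S k ^ q + C * Y N := by
    rw [hX, hY, Finset.mul_sum, Finset.mul_sum, ← Finset.sum_add_distrib]
    refine Finset.sum_le_sum fun k _ => ?_
    have h2 := h (S k) (c k) (hS0 k) (hc k)
    have h3 : S (k + 1) = S k + c k := Finset.sum_range_succ _ _
    rw [h3]
    calc R / 2 ^ k * (S k + c k) ^ q ≤ R / 2 ^ k * (3 / 2 * S k ^ q + C * c k ^ q) := by gcongr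
      _ = _ := by ring
  have h2 := key N
  show X N ≤ 4 * C * Y N
  linarith

/-! ### Equilibrium weights of a finite energy -/

/-- Existence of equilibrium weights. For the energy `∑ j, w j * (∑ i ∈ S j, m i) ^ (q + 1)` of
a finite family of sets there are weights `m ≥ 0` whose potential is at least `1` everywhere and
at most `1` where `m > 0`. They are found by minimizing the energy minus a multiple of the total
weight. -/
theorem exists_equilibrium_weights {ι J : Type*} [Fintype ι] [Fintype J] [DecidableEq ι]
    {q : ℝ} (hq : 0 < q) (w : J → ℝ) (hw : ∀ j, 0 ≤ w j) (S : J → Finset ι)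
    (hS : ∀ i, ∃ j, i ∈ S j ∧ 0 < w j) :
    ∃ m : ι → ℝ, (∀ i, 0 ≤ m i) ∧
      (∀ i, 1 ≤ ∑ j with i ∈ S j, w j * (∑ i' ∈ S j, m i') ^ q) ∧
      (∀ i, 0 < m i → ∑ j with i ∈ S j, w j * (∑ i' ∈ S j, m i') ^ q ≤ 1) := by
  classical
  set Φ : (ι → ℝ) → ℝ := fun m =>
    ∑ j, w j * (∑ i ∈ S j, m i) ^ (q + 1) - (q + 1) * ∑ i, m i with hΦ
  have hcont : Continuous Φ := by
    refine Continuous.sub (continuous_finsetSum _ fun j _ => ?_) (by fun_prop)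
    exact continuous_const.mul
      ((continuous_finsetSum _ fun i _ => continuous_apply i).rpow_const
        fun _ => Or.inr (by linarith))
  have hΦ0 : Φ 0 = 0 := by simp [hΦ, Real.zero_rpow (by linarith : q + 1 ≠ 0)]
  -- coercivity on the orthant: `Φ` is positive as soon as one coordinate is large
  obtain ⟨B, hB0, hB⟩ : ∃ B : ℝ, 0 ≤ B ∧ ∀ m : ι → ℝ, (∀ i, 0 ≤ m i) → Φ m ≤ 0 →
      ∀ i, m i ≤ B := by
    choose j hj hwj using hS
    refine ⟨∑ i, ((q + 1) * Fintype.card ι / w (j i)) ^ (1 / q),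
      Finset.sum_nonneg fun i _ => by have := hwj i; positivity, fun m hm hle i => ?_⟩
    obtain ⟨i₀, -, hi₀⟩ := Finset.exists_max_image Finset.univ m ⟨i, Finset.mem_univ i⟩
    refine (hi₀ i (Finset.mem_univ i)).trans ?_
    refine le_trans ?_ (Finset.single_le_sum
      (f := fun i => ((q + 1) * Fintype.card ι / w (j i)) ^ (1 / q))
      (fun i _ => by have := hwj i; positivity) (Finset.mem_univ i₀))
    rcases (hm i₀).eq_or_lt with h0 | hpos
    · rw [← h0]; have := hwj i₀; positivity
    · have h1 : w (j i₀) * m i₀ ^ (q + 1) ≤ ∑ j, w j * (∑ i ∈ S j, m i) ^ (q + 1) := by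
        refine le_trans ?_ (Finset.single_le_sum
          (f := fun j => w j * (∑ i ∈ S j, m i) ^ (q + 1)) (fun j _ => mul_nonneg (hw j)
            (Real.rpow_nonneg (Finset.sum_nonneg fun i _ => hm i) _)) (Finset.mem_univ (j i₀)))
        have := Finset.single_le_sum (fun i _ => hm i) (hj i₀)
        have hw' := hw (j i₀)
        gcongr
      have h2 : ∑ i, m i ≤ Fintype.card ι * m i₀ := by
        have := Finset.sum_le_card_nsmul Finset.univ m (m i₀) fun i hi => hi₀ i hi
        simpa using this
      have h3 : w (j i₀) * m i₀ ^ (q + 1) ≤ (q + 1) * (Fintype.card ι * m i₀) := by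
        have : (q + 1) * ∑ i, m i ≤ (q + 1) * (Fintype.card ι * m i₀) := by gcongr
        simp only [hΦ] at hle
        linarith
      rw [Real.rpow_add_one hpos.ne'] at h3
      have h4 : m i₀ ^ q ≤ (q + 1) * Fintype.card ι / w (j i₀) := by
        rw [le_div_iff₀ (hwj i₀)]
        refine le_of_mul_le_mul_right (a := m i₀) ?_ hpos
        nlinarith
      calc m i₀ = (m i₀ ^ q) ^ (1 / q) := by
            rw [← Real.rpow_mul hpos.le, mul_one_div_cancel hq.ne', Real.rpow_one]
        _ ≤ _ := Real.rpow_le_rpow (by positivity) h4 (by positivity)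
  obtain ⟨m, hmB, hmin⟩ := (isCompact_Icc (a := (0 : ι → ℝ)) (b := fun _ => B)).exists_isMinOn
    ⟨0, ⟨le_rfl, fun _ => hB0⟩⟩ hcont.continuousOn
  have hm : ∀ i, 0 ≤ m i := hmB.1
  have hglob : ∀ m' : ι → ℝ, (∀ i, 0 ≤ m' i) → Φ m ≤ Φ m' := by
    intro m' hm'
    by_cases hle : Φ m' ≤ 0
    · exact hmin ⟨hm', fun i => hB m' hm' hle i⟩
    · have : Φ m ≤ Φ 0 := hmin ⟨le_rfl, fun _ => hB0⟩
      linarith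
  -- the potential with the `i`-th coordinate moved by `h`
  set V : ι → ℝ → ℝ := fun i h => ∑ j with i ∈ S j, w j * (∑ i' ∈ S j, m i' + h) ^ q with hV
  have hVc : ∀ i, Continuous (V i) := fun i =>
    continuous_finsetSum _ fun j _ => continuous_const.mul
      ((continuous_const.add continuous_id).rpow_const fun _ => Or.inr hq.le)
  -- the tangent inequality turns minimality into a bound for the moved potential
  have hvar : ∀ i h, 0 ≤ m i + h → 0 ≤ h * (V i h - 1) := by
    intro i h hi
    set m' : ι → ℝ := fun i' => m i' + if i' = i then h else 0 with hm'
    have hm'0 : ∀ i', 0 ≤ m' i' := by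
      intro i'
      by_cases e : i' = i
      · subst e; simpa [hm'] using hi
      · simpa [hm', e] using hm i'
    have hsum : ∀ T : Finset ι, ∑ i' ∈ T, m' i' = ∑ i' ∈ T, m i' + if i ∈ T then h else 0 := by
      intro T
      simp [hm', Finset.sum_add_distrib, Finset.sum_ite_eq']
    have h1 := hglob m' hm'0
    have h2 : ∑ j, w j * (∑ i ∈ S j, m' i) ^ (q + 1) - ∑ j, w j * (∑ i ∈ S j, m i) ^ (q + 1) ≤
        (q + 1) * (h * V i h) := by
      rw [← Finset.sum_sub_distrib, hV]
      simp only
      rw [Finset.sum_filter, Finset.mul_sum, Finset.mul_sum]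
      refine Finset.sum_le_sum fun j _ => ?_
      rw [← mul_sub]
      have h3 := rpow_sub_rpow_le_mul_sub hq (Finset.sum_nonneg fun i (_ : i ∈ S j) => hm i)
        (Finset.sum_nonneg fun i (_ : i ∈ S j) => hm'0 i)
      rw [hsum] at h3 ⊢
      by_cases hij : i ∈ S j
      · simp only [hij, if_true] at h3 ⊢
        calc _ ≤ w j * _ := mul_le_mul_of_nonneg_left h3 (hw j)
          _ = _ := by ring
      · simp [hij]
    have h3 := hsum Finset.univ
    simp only [Finset.mem_univ, if_true] at h3
    simp only [hΦ, h3] at h1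
    have h4 : 0 ≤ (q + 1) * (h * (V i h - 1)) := by linarith
    exact nonneg_of_mul_nonneg_right h4 (by linarith)
  have hV0 : ∀ i, V i 0 = ∑ j with i ∈ S j, w j * (∑ i' ∈ S j, m i') ^ q := by
    intro i; simp [hV]
  refine ⟨m, hm, fun i => ?_, fun i hi => ?_⟩
  · rw [← hV0]
    refine ge_of_tendsto (((hVc i).tendsto 0).mono_left (nhdsWithin_le_nhds (s := Ioi 0))) ?_
    filter_upwards [self_mem_nhdsWithin] with h (hh : 0 < h)
    have := hvar i h (by linarith [hm i])
    have := nonneg_of_mul_nonneg_right this hh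
    linarith
  · rw [← hV0]
    refine le_of_tendsto (((hVc i).tendsto 0).mono_left (nhdsWithin_le_nhds (s := Iio 0))) ?_
    have : ∀ᶠ h in 𝓝[<] (0 : ℝ), -m i < h :=
      mem_nhdsWithin_of_mem_nhds (Ioi_mem_nhds (by linarith))
    filter_upwards [self_mem_nhdsWithin, this] with h (hh : h < 0) hh'
    have := hvar i h (by linarith)
    nlinarith

/-! ### Equilibrium masses on a finite set of points -/

/-- A maximal `r`-separated subfamily of a finite family of points in `ℝⁿ`: it is `r`-dense in
the family, and a ball of radius `2 * r` contains at most `5 ^ n` of its points. -/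
theorem exists_separated_net {n : ℕ} {ι : Type*} (x : ι → EuclideanSpace ℝ (Fin n))
    (T : Finset ι) {r : ℝ} (hr : 0 < r) :
    ∃ D ⊆ T, (∀ i ∈ T, ∃ y ∈ D, dist (x i) (x y) < r) ∧
      ∀ z, (D.filter fun y => dist z (x y) < 2 * r).card ≤ 5 ^ n := by
  classical
  set A : Finset (Finset ι) := T.powerset.filter fun D => ∀ i ∈ D, ∀ j ∈ D, i ≠ j →
    r ≤ dist (x i) (x j) with hA
  obtain ⟨D, hD⟩ := A.exists_maximal ⟨∅, by simp [hA]⟩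
  have hDA := hD.prop
  simp only [hA, Finset.mem_filter, Finset.mem_powerset] at hDA
  refine ⟨D, hDA.1, fun i hi => ?_, fun z => ?_⟩
  · by_contra! hcon
    have hmem : insert i D ∈ A := by
      simp only [hA, Finset.mem_filter, Finset.mem_powerset]
      refine ⟨Finset.insert_subset hi hDA.1, ?_⟩
      intro a ha b hb hab
      rcases Finset.mem_insert.1 ha with rfl | haD <;>
        rcases Finset.mem_insert.1 hb with rfl | hbD
      · exact absurd rfl hab
      · exact hcon b hbD
      · rw [dist_comm]; exact hcon a haD
      · exact hDA.2 a haD b hbD hab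
    have hiD : i ∈ D := hD.le_of_ge hmem (Finset.subset_insert i D) (Finset.mem_insert_self i D)
    have := hcon i hiD
    rw [dist_self] at this
    linarith
  · set F := D.filter fun y => dist z (x y) < 2 * r with hF
    set φ : ι → EuclideanSpace ℝ (Fin n) := fun y => r⁻¹ • (x y - z) with hφ
    have hdist : ∀ c d : ι, ‖φ c - φ d‖ = r⁻¹ * dist (x c) (x d) := by
      intro c d
      rw [hφ]
      simp only
      rw [← smul_sub, norm_smul, sub_sub_sub_cancel_right, ← dist_eq_norm, Real.norm_of_nonneg
        (by positivity)]
    have hsep : ∀ c ∈ F, ∀ d ∈ F, c ≠ d → 1 ≤ ‖φ c - φ d‖ := by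
      intro c hc d hd hcd
      have := hDA.2 c (Finset.mem_filter.1 hc).1 d (Finset.mem_filter.1 hd).1 hcd
      rw [hdist, ← div_eq_inv_mul, le_div_iff₀ hr]
      linarith
    have hinj : Set.InjOn φ F := by
      intro c hc d hd hcd
      by_contra hne
      have := hsep c hc d hd hne
      rw [hcd, sub_self, norm_zero] at this
      linarith
    have hcard := Besicovitch.card_le_of_separated (F.image φ) (by
      intro c hc
      obtain ⟨y, hy, rfl⟩ := Finset.mem_image.1 hc
      have hy2 := (Finset.mem_filter.1 hy).2
      rw [dist_comm, dist_eq_norm] at hy2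
      simp only [hφ]
      rw [norm_smul, Real.norm_of_nonneg (by positivity), ← div_eq_inv_mul, div_le_iff₀ hr]
      exact hy2.le) (by
      intro c hc d hd hcd
      obtain ⟨y, hy, rfl⟩ := Finset.mem_image.1 hc
      obtain ⟨y', hy', rfl⟩ := Finset.mem_image.1 hd
      exact hsep y hy y' hy' fun h => hcd (by rw [h]))
    rw [Finset.card_image_of_injOn hinj] at hcard
    simpa using hcard

theorem sum_fin_ite_le_eq_sum_range {N K : ℕ} (h : K ≤ N) (f : ℕ → ℝ) :
    ∑ k : Fin (N + 1), (if (k : ℕ) ≤ K then f k else 0) = ∑ k ∈ Finset.range (K + 1), f k := by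
  rw [Fin.sum_univ_eq_sum_range (fun k => if k ≤ K then f k else 0) (N + 1), ← Finset.sum_filter]
  refine Finset.sum_congr ?_ fun _ _ => rfl
  ext k
  simp only [Finset.mem_filter, Finset.mem_range]
  omega

/-- Equilibrium masses for the Wolff potential on finitely many points. The point `x i` only sees
the scales `R / 2 ^ k` with `k ≤ κ i`, and at the scale `k` only the points with `k ≤ κ j` are
charged to the energy. The sets defining the energy are balls centred at the points of separated
nets, so that they have bounded overlap. -/
theorem exists_equilibrium_masses {n : ℕ} {q R : ℝ} (hq : 0 < q) (hR : 0 < R)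
    {ι : Type*} [Fintype ι] (x : ι → EuclideanSpace ℝ (Fin n)) (κ : ι → ℕ)
    (a : ℕ → ℝ) (ha : ∀ k, 0 < a k) :
    ∃ m : ι → ℝ, (∀ i, 0 ≤ m i) ∧
      (∀ i, 1 ≤ 5 ^ n * ∑ k ∈ Finset.range (κ i + 1),
        a k * (∑ j with dist (x j) (x i) < 8 * (R / 2 ^ k), m j) ^ q) ∧
      (∀ i, 0 < m i → ∑ k ∈ Finset.range (κ i + 1),
        a k * (∑ j with k ≤ κ j ∧ dist (x j) (x i) < 2 * (R / 2 ^ k), m j) ^ q ≤ 1) := by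
  classical
  have hr : ∀ k : ℕ, 0 < R / 2 ^ k := fun k => by positivity
  choose D hDsub hDnet hDcard using fun k : ℕ =>
    exists_separated_net x (Finset.univ.filter fun i => k ≤ κ i)
      (r := 2 * (R / 2 ^ k)) (by have := hr k; positivity)
  set N := Finset.univ.sup κ with hN
  have hκN : ∀ i, κ i ≤ N := fun i => Finset.le_sup (Finset.mem_univ i)
  set w : Fin (N + 1) × ι → ℝ := fun j => if j.2 ∈ D j.1 then a j.1 else 0 with hw
  set S : Fin (N + 1) × ι → Finset ι := fun j =>
    Finset.univ.filter fun i => (j.1 : ℕ) ≤ κ i ∧ dist (x i) (x j.2) < 2 * (2 * (R / 2 ^ (j.1 : ℕ)))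
    with hSdef
  have hcov : ∀ i, ∃ j, i ∈ S j ∧ 0 < w j := by
    intro i
    obtain ⟨y, hy, hd⟩ := hDnet 0 i (by simp)
    refine ⟨(0, y), ?_, ?_⟩
    · simp only [hSdef, Finset.mem_filter, Finset.mem_univ, true_and]
      refine ⟨by simp, ?_⟩
      have := hr 0
      simp only [Fin.val_zero]
      linarith
    · have : y ∈ D ((0 : Fin (N + 1)) : ℕ) := hy
      simp only [hw, this, if_true]
      exact ha _
  obtain ⟨m, hm, hlow, hup⟩ := exists_equilibrium_weights hq w
    (fun j => by simp only [hw]; split_ifs; exacts [(ha _).le, le_rfl]) S hcov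
  have hpot : ∀ i, ∑ j with i ∈ S j, w j * (∑ i' ∈ S j, m i') ^ q =
      ∑ k : Fin (N + 1), ∑ y ∈ D k, if i ∈ S (k, y) then
        a k * (∑ i' ∈ S (k, y), m i') ^ q else 0 := by
    intro i
    rw [Finset.sum_filter, Fintype.sum_prod_type]
    refine Finset.sum_congr rfl fun k _ => ?_
    rw [← Finset.sum_subset (Finset.subset_univ (D k)) fun y _ hy => by simp [hw, hy]]
    refine Finset.sum_congr rfl fun y hy => ?_
    simp [hw, hy]
  refine ⟨m, hm, fun i => ?_, fun i hi => ?_⟩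
  · refine (hlow i).trans ?_
    rw [hpot, Finset.mul_sum, ← sum_fin_ite_le_eq_sum_range (hκN i)]
    refine Finset.sum_le_sum fun k _ => ?_
    split_ifs with hk
    · rw [← Finset.sum_filter]
      have hle : ∀ y ∈ (D k).filter fun y => i ∈ S (k, y),
          a k * (∑ i' ∈ S (k, y), m i') ^ q ≤
            a k * (∑ j with dist (x j) (x i) < 8 * (R / 2 ^ (k : ℕ)), m j) ^ q := by
        intro y hy
        have hiy : dist (x i) (x y) < 2 * (2 * (R / 2 ^ (k : ℕ))) := by
          have := (Finset.mem_filter.1 hy).2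
          simp only [hSdef, Finset.mem_filter] at this
          exact this.2.2
        refine mul_le_mul_of_nonneg_left (Real.rpow_le_rpow (Finset.sum_nonneg fun i _ => hm i)
          (Finset.sum_le_sum_of_subset_of_nonneg (fun j hj => ?_) fun i _ _ => hm i) hq.le)
          (ha _).le
        simp only [hSdef, Finset.mem_filter, Finset.mem_univ, true_and] at hj ⊢
        have := dist_triangle_right (x j) (x i) (x y)
        linarith [hj.2]
      refine (Finset.sum_le_card_nsmul _ _ _ hle).trans ?_
      rw [nsmul_eq_mul]
      refine mul_le_mul_of_nonneg_right ?_ (mul_nonneg (ha _).le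
        (Real.rpow_nonneg (Finset.sum_nonneg fun i _ => hm i) _))
      have h1 : ((D k).filter fun y => i ∈ S (k, y)).card ≤ 5 ^ n := by
        refine (Finset.card_le_card fun y hy => ?_).trans (hDcard k (x i))
        simp only [hSdef, Finset.mem_filter, Finset.mem_univ, true_and] at hy ⊢
        exact ⟨hy.1, hy.2.2⟩
      exact_mod_cast h1
    · refine (Finset.sum_eq_zero fun y _ => ?_).le
      simp [hSdef, hk]
  · refine le_trans ?_ (hup i hi)
    rw [hpot, ← sum_fin_ite_le_eq_sum_range (hκN i)]
    refine Finset.sum_le_sum fun k _ => ?_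
    have hnn : ∀ y ∈ D k, 0 ≤ if i ∈ S (k, y) then
        a k * (∑ i' ∈ S (k, y), m i') ^ q else 0 := by
      intro y _
      split_ifs
      · exact mul_nonneg (ha _).le (Real.rpow_nonneg (Finset.sum_nonneg fun i _ => hm i) _)
      · exact le_rfl
    split_ifs with hk
    · obtain ⟨y, hy, hd⟩ := hDnet k i (by simpa using hk)
      refine le_trans ?_ (Finset.single_le_sum hnn hy)
      have hiS : i ∈ S (k, y) := by
        simp only [hSdef, Finset.mem_filter, Finset.mem_univ, true_and]
        refine ⟨hk, ?_⟩
        have := hr k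
        linarith
      rw [if_pos hiS]
      refine mul_le_mul_of_nonneg_left (Real.rpow_le_rpow (Finset.sum_nonneg fun i _ => hm i)
          (Finset.sum_le_sum_of_subset_of_nonneg (fun j hj => ?_) fun i _ _ => hm i) hq.le)
          (ha _).le
      simp only [hSdef, Finset.mem_filter, Finset.mem_univ, true_and] at hj ⊢
      refine ⟨hj.1, ?_⟩
      have := dist_triangle (x j) (x i) (x y)
      linarith [hj.2]
    · exact Finset.sum_nonneg hnn

/-! ### Wolff's inequality -/

/-- The mass `∑ m j` of the points `x j` with `k ≤ κ j` in the ball `B(y, r)`. -/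
noncomputable def levelMass {n : ℕ} {ι : Type*} [Fintype ι] (x : ι → EuclideanSpace ℝ (Fin n))
    (κ : ι → ℕ) (m : ι → ℝ) (k : ℕ) (y : EuclideanSpace ℝ (Fin n)) (r : ℝ) : ℝ :=
  open Classical in ∑ j with k ≤ κ j ∧ dist (x j) y < r, m j

/-- The truncated dyadic Riesz potential of order one of the point masses `m j` at `x j`; the
mass at `x j` enters at the scales `R / 2 ^ k` with `k ≤ κ j` only. -/
noncomputable def dyadicRiesz {n : ℕ} {ι : Type*} [Fintype ι] (x : ι → EuclideanSpace ℝ (Fin n))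
    (κ : ι → ℕ) (m : ι → ℝ) (R : ℝ) (N : ℕ) (y : EuclideanSpace ℝ (Fin n)) : ℝ :=
  ∑ k ∈ Finset.range N, R / 2 ^ k / (R / 2 ^ k) ^ n * levelMass x κ m k y (R / 2 ^ k)

theorem levelMass_nonneg {n : ℕ} {ι : Type*} [Fintype ι] {x : ι → EuclideanSpace ℝ (Fin n)}
    {κ : ι → ℕ} {m : ι → ℝ} (hm : ∀ i, 0 ≤ m i) (k : ℕ) (y : EuclideanSpace ℝ (Fin n)) (r : ℝ) :
    0 ≤ levelMass x κ m k y r :=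
  Finset.sum_nonneg fun i _ => hm i

theorem levelMass_eq_sum_indicator {n : ℕ} {ι : Type*} [Fintype ι]
    (x : ι → EuclideanSpace ℝ (Fin n)) (κ : ι → ℕ) (m : ι → ℝ) (k : ℕ)
    (y : EuclideanSpace ℝ (Fin n)) (r : ℝ) :
    levelMass x κ m k y r =
      ∑ j, (Metric.ball (x j) r).indicator (fun _ => if k ≤ κ j then m j else 0) y := by
  classical
  unfold levelMass
  rw [Finset.sum_filter]
  refine Finset.sum_congr rfl fun j _ => ?_
  by_cases h1 : k ≤ κ j <;> by_cases h2 : dist (x j) y < r <;>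
    simp [Set.indicator, Metric.mem_ball, dist_comm y, h1, h2]

theorem measurable_levelMass {n : ℕ} {ι : Type*} [Fintype ι]
    (x : ι → EuclideanSpace ℝ (Fin n)) (κ : ι → ℕ) (m : ι → ℝ) (k : ℕ) (r : ℝ) :
    Measurable fun y => levelMass x κ m k y r := by
  simp only [levelMass_eq_sum_indicator]
  exact Finset.measurable_fun_sum _ fun j _ => measurable_const.indicator measurableSet_ball

theorem measurable_dyadicRiesz {n : ℕ} {ι : Type*} [Fintype ι]
    (x : ι → EuclideanSpace ℝ (Fin n)) (κ : ι → ℕ) (m : ι → ℝ) (R : ℝ) (N : ℕ) :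
    Measurable fun y => dyadicRiesz x κ m R N y :=
  Finset.measurable_fun_sum _ fun k _ => (measurable_levelMass x κ m k _).const_mul _

theorem dyadicRiesz_nonneg {n : ℕ} {ι : Type*} [Fintype ι] {x : ι → EuclideanSpace ℝ (Fin n)}
    {κ : ι → ℕ} {m : ι → ℝ} {R : ℝ} (hR : 0 < R) (hm : ∀ i, 0 ≤ m i) (N : ℕ)
    (y : EuclideanSpace ℝ (Fin n)) : 0 ≤ dyadicRiesz x κ m R N y :=
  Finset.sum_nonneg fun k _ => mul_nonneg (by positivity) (levelMass_nonneg hm _ _ _)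

/-- **Wolff's inequality**, for masses whose truncated Wolff potential is at most `1` on their
support. After summation by parts the inner partial sum only involves scales coarser than the
outer one, so it can be evaluated at the charged point, where Hardy's inequality applies. -/
theorem exists_lintegral_dyadicRiesz_rpow_le (n : ℕ) {q : ℝ} (hq : 0 < q) :
    ∃ C : ℝ, 0 < C ∧ ∀ (R : ℝ) (ι : Type) [Fintype ι] (x : ι → EuclideanSpace ℝ (Fin n))
      (κ : ι → ℕ) (m : ι → ℝ), 0 < R → (∀ i, 0 ≤ m i) →
      (∀ i, 0 < m i → ∑ k ∈ Finset.range (κ i + 1),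
        R / 2 ^ k * (R / 2 ^ k / (R / 2 ^ k) ^ n) ^ q *
          levelMass x κ m k (x i) (2 * (R / 2 ^ k)) ^ q ≤ 1) →
      ∀ N, ∫⁻ y, ENNReal.ofReal (dyadicRiesz x κ m R N y) ^ (q + 1) ≤
        ENNReal.ofReal (C * ∑ i, m i) := by
  obtain ⟨CH, hCH, hardy⟩ := exists_hardy_geometric hq
  set v : ℝ := (volume (Metric.ball (0 : EuclideanSpace ℝ (Fin n)) 1)).toReal with hv
  have hv0 : 0 < v := ENNReal.toReal_pos (Metric.measure_ball_pos _ _ one_pos).ne'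
    measure_ball_lt_top.ne
  refine ⟨(q + 1) * v * CH, by positivity, fun R ι _ x κ m hR hm hpot N => ?_⟩
  have hr : ∀ k : ℕ, 0 < R / 2 ^ k := fun k => by positivity
  set b : ℕ → EuclideanSpace ℝ (Fin n) → ℝ := fun k y =>
    R / 2 ^ k / (R / 2 ^ k) ^ n * levelMass x κ m k y (R / 2 ^ k) with hb
  have hb0 : ∀ k y, 0 ≤ b k y := fun k y =>
    mul_nonneg (by positivity) (levelMass_nonneg hm _ _ _)
  set c : ι → ℕ → ℝ := fun j k =>
    R / 2 ^ k / (R / 2 ^ k) ^ n * levelMass x κ m k (x j) (2 * (R / 2 ^ k)) with hc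
  have hc0 : ∀ j k, 0 ≤ c j k := fun j k =>
    mul_nonneg (by positivity) (levelMass_nonneg hm _ _ _)
  set H : ι → ℕ → ℝ := fun j k => (∑ l ∈ Finset.range (k + 1), c j l) ^ q with hH
  have hH0 : ∀ j k, 0 ≤ H j k := fun j k =>
    Real.rpow_nonneg (Finset.sum_nonneg fun l _ => hc0 j l) _
  set d : ι → ℕ → ℝ := fun j k =>
    (q + 1) * (R / 2 ^ k / (R / 2 ^ k) ^ n * (if k ≤ κ j then m j else 0) * H j k) with hd
  have hmk0 : ∀ j k, 0 ≤ if k ≤ κ j then m j else 0 := fun j k => by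
    split_ifs; exacts [hm j, le_rfl]
  have hd0 : ∀ j k, 0 ≤ d j k := fun j k => by
    have := hH0 j k
    have := hmk0 j k
    positivity
  -- the pointwise bound of `dyadicRiesz ^ (q + 1)` by a simple function
  have hpt : ∀ y, dyadicRiesz x κ m R N y ^ (q + 1) ≤
      ∑ k ∈ Finset.range N, ∑ j, (Metric.ball (x j) (R / 2 ^ k)).indicator (fun _ => d j k) y := by
    intro y
    refine (rpow_sum_range_le hq (fun k => b k y) (fun k => hb0 k y) N).trans ?_
    rw [Finset.mul_sum]
    refine Finset.sum_le_sum fun k _ => ?_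
    have hbk : b k y = ∑ j, (Metric.ball (x j) (R / 2 ^ k)).indicator
        (fun _ => R / 2 ^ k / (R / 2 ^ k) ^ n * (if k ≤ κ j then m j else 0)) y := by
      simp only [hb]
      rw [levelMass_eq_sum_indicator, Finset.mul_sum]
      refine Finset.sum_congr rfl fun j _ => ?_
      simp only [Set.indicator]
      split_ifs <;> simp
    rw [hbk, Finset.sum_mul, Finset.mul_sum]
    refine Finset.sum_le_sum fun j _ => ?_
    by_cases hy : y ∈ Metric.ball (x j) (R / 2 ^ k)
    · rw [indicator_of_mem hy, indicator_of_mem hy]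
      have hle : ∑ l ∈ Finset.range (k + 1), b l y ≤ ∑ l ∈ Finset.range (k + 1), c j l := by
        refine Finset.sum_le_sum fun l hl => ?_
        refine mul_le_mul_of_nonneg_left ?_ (by positivity)
        refine Finset.sum_le_sum_of_subset_of_nonneg (fun i hi => ?_) fun i _ _ => hm i
        simp only [Finset.mem_filter, Finset.mem_univ, true_and] at hi ⊢
        refine ⟨hi.1, ?_⟩
        have h1 : R / 2 ^ k ≤ R / 2 ^ l := by
          have : l ≤ k := by simpa [Nat.lt_succ_iff] using hl
          gcongr
          norm_num
        have h2 := dist_triangle (x i) y (x j)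
        rw [Metric.mem_ball] at hy
        linarith [hi.2]
      have h3 : (∑ l ∈ Finset.range (k + 1), b l y) ^ q ≤ H j k :=
        Real.rpow_le_rpow (Finset.sum_nonneg fun l _ => hb0 l y) hle hq.le
      have := hmk0 j k
      simp only [hd]
      gcongr
    · rw [indicator_of_notMem hy, indicator_of_notMem hy]
      simp
  have hvol : ∀ j k, volume (Metric.ball (x j) (R / 2 ^ k)) =
      ENNReal.ofReal ((R / 2 ^ k) ^ n * v) := by
    intro j k
    rw [Measure.addHaar_ball_of_pos _ _ (hr k), finrank_euclideanSpace_fin,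
      ENNReal.ofReal_mul (by positivity), hv, ENNReal.ofReal_toReal measure_ball_lt_top.ne]
  calc ∫⁻ y, ENNReal.ofReal (dyadicRiesz x κ m R N y) ^ (q + 1)
      ≤ ∫⁻ y, ∑ k ∈ Finset.range N, ∑ j,
          (Metric.ball (x j) (R / 2 ^ k)).indicator (fun _ => ENNReal.ofReal (d j k)) y := by
        refine lintegral_mono fun y => ?_
        rw [ENNReal.ofReal_rpow_of_nonneg (dyadicRiesz_nonneg hR hm N y) (by linarith)]
        refine (ENNReal.ofReal_le_ofReal (hpt y)).trans (le_of_eq ?_)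
        have hnn : ∀ j k, 0 ≤ (Metric.ball (x j) (R / 2 ^ k)).indicator (fun _ => d j k) y :=
          fun j k => indicator_nonneg (fun _ _ => hd0 j k) y
        rw [ENNReal.ofReal_sum_of_nonneg fun k _ => Finset.sum_nonneg fun j _ => hnn j k]
        refine Finset.sum_congr rfl fun k _ => ?_
        rw [ENNReal.ofReal_sum_of_nonneg fun j _ => hnn j k]
        refine Finset.sum_congr rfl fun j _ => ?_
        simp only [Set.indicator]
        split_ifs <;> simp
    _ = ∑ k ∈ Finset.range N, ∑ j, ENNReal.ofReal (d j k * ((R / 2 ^ k) ^ n * v)) := by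
        rw [lintegral_finsetSum _ fun k _ => Finset.measurable_fun_sum _ fun j _ =>
          measurable_const.indicator measurableSet_ball]
        refine Finset.sum_congr rfl fun k _ => ?_
        rw [lintegral_finsetSum _ fun j _ => measurable_const.indicator measurableSet_ball]
        refine Finset.sum_congr rfl fun j _ => ?_
        rw [lintegral_indicator_const measurableSet_ball, hvol, ENNReal.ofReal_mul (hd0 j k)]
    _ = ENNReal.ofReal (∑ k ∈ Finset.range N, ∑ j, d j k * ((R / 2 ^ k) ^ n * v)) := by
        have hnn : ∀ j k, 0 ≤ d j k * ((R / 2 ^ k) ^ n * v) := fun j k => by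
          have := hd0 j k
          positivity
        rw [ENNReal.ofReal_sum_of_nonneg fun k _ => Finset.sum_nonneg fun j _ => hnn j k]
        refine Finset.sum_congr rfl fun k _ => ?_
        rw [ENNReal.ofReal_sum_of_nonneg fun j _ => hnn j k]
    _ ≤ ENNReal.ofReal ((q + 1) * v * CH * ∑ i, m i) := by
        refine ENNReal.ofReal_le_ofReal ?_
        rw [Finset.sum_comm, Finset.mul_sum]
        refine Finset.sum_le_sum fun j _ => ?_
        have h1 : ∀ k, d j k * ((R / 2 ^ k) ^ n * v) =
            (q + 1) * v * m j * (if k < κ j + 1 then R / 2 ^ k * H j k else 0) := by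
          intro k
          have := (hr k).ne'
          simp only [hd, Nat.lt_succ_iff]
          split_ifs
          · field_simp
          · simp
        simp only [h1, ← Finset.mul_sum]
        have h2 : ∑ k ∈ Finset.range N, (if k < κ j + 1 then R / 2 ^ k * H j k else 0) ≤
            ∑ k ∈ Finset.range (κ j + 1), R / 2 ^ k * H j k := by
          rw [← Finset.sum_filter]
          refine Finset.sum_le_sum_of_subset_of_nonneg (fun k hk => ?_) fun k _ _ =>
            mul_nonneg (hr k).le (hH0 j k)
          simpa using (Finset.mem_filter.1 hk).2
        rcases (hm j).eq_or_lt with h0 | hpos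
        · simp [← h0]
        have h3 := hardy R (c j) hR.le (hc0 j) (κ j + 1)
        have h4 : ∑ k ∈ Finset.range (κ j + 1), R / 2 ^ k * c j k ^ q ≤ 1 := by
          refine le_trans (le_of_eq (Finset.sum_congr rfl fun k _ => ?_)) (hpot j hpos)
          simp only [hc]
          rw [Real.mul_rpow (by positivity) (levelMass_nonneg hm _ _ _), mul_assoc]
        have h5 : ∑ k ∈ Finset.range N, (if k < κ j + 1 then R / 2 ^ k * H j k else 0) ≤ CH := by
          refine h2.trans (h3.trans ?_)
          nlinarith
        calc _ ≤ (q + 1) * v * m j * CH := by gcongr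
          _ = _ := by ring

/-! ### Pointwise bound of a smooth function by its gradient -/

theorem setLIntegral_ball_comp_add_smul {n : ℕ} {F : EuclideanSpace ℝ (Fin n) → ℝ≥0∞}
    (hF : Measurable F) (x : EuclideanSpace ℝ (Fin n)) {t : ℝ} (ht : 0 < t) :
    ∫⁻ z in Metric.ball 0 1, F (x + t • z) =
      ENNReal.ofReal ((t ^ n)⁻¹) * ∫⁻ y in Metric.ball x t, F y := by
  have hG : Measurable ((Metric.ball x t).indicator F) := hF.indicator measurableSet_ball
  have h1 : ∀ z, (Metric.ball (0 : EuclideanSpace ℝ (Fin n)) 1).indicator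
      (fun z => F (x + t • z)) z = (Metric.ball x t).indicator F (x + t • z) := by
    intro z
    simp only [Set.indicator, Metric.mem_ball, dist_self_add_left, dist_zero_right, norm_smul,
      Real.norm_of_nonneg ht.le]
    have : ‖z‖ < 1 ↔ t * ‖z‖ < t := by
      constructor <;> intro h <;> nlinarith
    simp only [this]
  rw [← lintegral_indicator measurableSet_ball, ← lintegral_indicator measurableSet_ball]
  simp only [h1]
  have h2 := lintegral_map (μ := (volume : Measure (EuclideanSpace ℝ (Fin n))))
    (f := fun w => (Metric.ball x t).indicator F (x + w)) (g := fun z => t • z)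
    (hG.comp (measurable_const_add x)) (measurable_const_smul t)
  rw [← h2, Measure.map_addHaar_smul _ ht.ne', lintegral_smul_measure,
    lintegral_add_left_eq_self, finrank_euclideanSpace_fin, abs_of_pos (by positivity), smul_eq_mul]

theorem setLIntegral_Ioc_le_sum_dyadic {R : ℝ} (hR : 0 < R) (h : ℝ → ℝ≥0∞) (K : ℕ) :
    ∫⁻ t in Ioc (R / 2 ^ K) R, h t ≤
      ∑ k ∈ Finset.range K, ∫⁻ t in Ioc (R / 2 ^ (k + 1)) (R / 2 ^ k), h t := by
  induction K with
  | zero => simp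
  | succ K ih =>
    rw [Finset.sum_range_succ]
    have h1 : R / 2 ^ (K + 1) ≤ R / 2 ^ K := by
      gcongr <;> norm_num
    have h2 : R / 2 ^ K ≤ R := div_le_self hR.le (one_le_pow₀ (by norm_num))
    rw [← Ioc_union_Ioc_eq_Ioc h1 h2]
    refine (lintegral_union_le _ _ _).trans ?_
    rw [add_comm]
    gcongr

/-- A function that is at least `1` on `B(x, R / 2 ^ K)` and vanishes far away is controlled by
the averages of its gradient over the larger dyadic balls around `x`: the increment of `u` along
the segments from `x + (R / 2 ^ K) z` to `x + R z` is averaged over the directions `z` in an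
annulus. -/
theorem exists_one_le_sum_lintegral_fderiv {n : ℕ} (hn : 0 < n) :
    ∃ C : ℝ, 0 < C ∧ ∀ (R : ℝ) (u : EuclideanSpace ℝ (Fin n) → ℝ)
      (x : EuclideanSpace ℝ (Fin n)) (K : ℕ), 0 < R → ContDiff ℝ ∞ u →
      tsupport u ⊆ Metric.ball 0 (R / 4) → ‖x‖ < R / 4 →
      (∀ y ∈ Metric.closedBall x (R / 2 ^ K), 1 ≤ u y) →
      1 ≤ ENNReal.ofReal C * ∑ k ∈ Finset.range K, ENNReal.ofReal (R / 2 ^ k / (R / 2 ^ k) ^ n) *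
        ∫⁻ y in Metric.ball x (R / 2 ^ k), ‖fderiv ℝ u y‖ₑ := by
  set A : Set (EuclideanSpace ℝ (Fin n)) :=
    Metric.ball 0 1 ∩ (Metric.closedBall 0 (1 / 2))ᶜ with hA
  have hAo : IsOpen A := Metric.isOpen_ball.inter Metric.isClosed_closedBall.isOpen_compl
  have hAne : A.Nonempty := by
    refine ⟨EuclideanSpace.single ⟨0, hn⟩ (3 / 4 : ℝ), ?_, ?_⟩
    · simp; norm_num
    · simp; norm_num
  have hApos : 0 < volume A := hAo.measure_pos _ hAne
  have hAtop : volume A ≠ ⊤ :=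
    ((measure_mono inter_subset_left).trans_lt measure_ball_lt_top).ne
  set vA : ℝ := (volume A).toReal with hvA
  have hvA0 : 0 < vA := ENNReal.toReal_pos hApos.ne' hAtop
  refine ⟨2 ^ n / vA, by positivity, fun R u x K hR hu hsupp hx hone => ?_⟩
  have hr : ∀ k : ℕ, 0 < R / 2 ^ k := fun k => by positivity
  set F : EuclideanSpace ℝ (Fin n) → ℝ≥0∞ := fun y => ‖fderiv ℝ u y‖ₑ with hF
  have hFd : Continuous (fderiv ℝ u) := hu.continuous_fderiv (by simp)
  have hFc : Continuous F := hFd.enorm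
  have hδR : R / 2 ^ K ≤ R := div_le_self hR.le (one_le_pow₀ (by norm_num))
  -- the increment along one segment
  have hseg : ∀ z ∈ A, 1 ≤ ∫⁻ t in Ioc (R / 2 ^ K) R, F (x + t • z) := by
    intro z hz
    have hz1 : ‖z‖ < 1 := by simpa using hz.1
    have hz2 : 1 / 2 < ‖z‖ := by simpa using hz.2
    have hder : ∀ t : ℝ, HasDerivAt (fun t : ℝ => u (x + t • z)) (fderiv ℝ u (x + t • z) z) t := by
      intro t
      have h1 : HasDerivAt (fun t : ℝ => x + t • z) z t := by
        simpa using ((hasDerivAt_id t).smul_const z).const_add x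
      exact ((hu.differentiable (by simp) _).hasFDerivAt).comp_hasDerivAt t h1
    have hcont : Continuous fun t : ℝ => fderiv ℝ u (x + t • z) z :=
      (hFd.comp (by fun_prop)).clm_apply continuous_const
    have hint := intervalIntegral.integral_eq_sub_of_hasDerivAt (fun t _ => hder t)
      (hcont.intervalIntegrable (R / 2 ^ K) R)
    have hu0 : u (x + R • z) = 0 := by
      refine image_eq_zero_of_notMem_tsupport fun hmem => ?_
      have h1 := hsupp hmem
      rw [mem_ball_zero_iff] at h1
      have h2 : ‖R • z‖ ≤ ‖x + R • z‖ + ‖x‖ := by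
        have := norm_sub_le (x + R • z) x
        simpa using this
      rw [norm_smul, Real.norm_of_nonneg hR.le] at h2
      nlinarith
    have hu1 : 1 ≤ u (x + (R / 2 ^ K) • z) := by
      refine hone _ ?_
      rw [Metric.mem_closedBall, dist_self_add_left, norm_smul, Real.norm_of_nonneg (hr K).le]
      nlinarith [hr K]
    rw [hu0, intervalIntegral.integral_of_le hδR] at hint
    calc (1 : ℝ≥0∞) = ENNReal.ofReal 1 := by simp
      _ ≤ ENNReal.ofReal ‖∫ t in Ioc (R / 2 ^ K) R, fderiv ℝ u (x + t • z) z‖ := by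
          refine ENNReal.ofReal_le_ofReal ?_
          rw [hint, zero_sub, norm_neg]
          exact hu1.trans (le_abs_self _)
      _ = ‖∫ t in Ioc (R / 2 ^ K) R, fderiv ℝ u (x + t • z) z‖ₑ := ofReal_norm _
      _ ≤ ∫⁻ t in Ioc (R / 2 ^ K) R, ‖fderiv ℝ u (x + t • z) z‖ₑ :=
          enorm_integral_le_lintegral_enorm _
      _ ≤ ∫⁻ t in Ioc (R / 2 ^ K) R, F (x + t • z) := by
          refine lintegral_mono fun t => ?_
          simp only [hF, ← ofReal_norm]
          refine ENNReal.ofReal_le_ofReal ?_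
          refine ((fderiv ℝ u (x + t • z)).le_opNorm z).trans ?_
          nlinarith [norm_nonneg (fderiv ℝ u (x + t • z))]
  have havg : volume A ≤ ∫⁻ t in Ioc (R / 2 ^ K) R, ∫⁻ z in A, F (x + t • z) := by
    calc volume A = ∫⁻ _ in A, 1 := by simp
      _ ≤ ∫⁻ z in A, ∫⁻ t in Ioc (R / 2 ^ K) R, F (x + t • z) :=
          setLIntegral_mono' hAo.measurableSet hseg
      _ = _ := by
          refine lintegral_lintegral_swap ?_
          refine Continuous.aemeasurable ?_
          exact hFc.comp (by fun_prop)
  have hscale : ∀ k : ℕ, ∫⁻ t in Ioc (R / 2 ^ (k + 1)) (R / 2 ^ k), ∫⁻ z in A, F (x + t • z) ≤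
      ENNReal.ofReal (2 ^ n) * (ENNReal.ofReal (R / 2 ^ k / (R / 2 ^ k) ^ n) *
        ∫⁻ y in Metric.ball x (R / 2 ^ k), F y) := by
    intro k
    have hle : ∀ t ∈ Ioc (R / 2 ^ (k + 1)) (R / 2 ^ k), ∫⁻ z in A, F (x + t • z) ≤
        ENNReal.ofReal (2 ^ n / (R / 2 ^ k) ^ n) * ∫⁻ y in Metric.ball x (R / 2 ^ k), F y := by
      intro t ht
      have ht0 : 0 < t := (hr _).trans ht.1
      calc ∫⁻ z in A, F (x + t • z) ≤ ∫⁻ z in Metric.ball 0 1, F (x + t • z) :=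
            lintegral_mono_set inter_subset_left
        _ = ENNReal.ofReal ((t ^ n)⁻¹) * ∫⁻ y in Metric.ball x t, F y :=
            setLIntegral_ball_comp_add_smul hFc.measurable x ht0
        _ ≤ _ := by
            refine mul_le_mul' (ENNReal.ofReal_le_ofReal ?_)
              (lintegral_mono_set (Metric.ball_subset_ball ht.2))
            have h2 : R / 2 ^ k / 2 = R / 2 ^ (k + 1) := by rw [pow_succ]; field_simp
            rw [← inv_div, ← div_pow, h2]
            gcongr
            exact ht.1.le
    refine (setLIntegral_mono' measurableSet_Ioc hle).trans ?_
    rw [setLIntegral_const, Real.volume_Ioc]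
    have h3 : ENNReal.ofReal (R / 2 ^ k - R / 2 ^ (k + 1)) ≤ ENNReal.ofReal (R / 2 ^ k) :=
      ENNReal.ofReal_le_ofReal (by linarith [hr (k + 1)])
    refine (mul_le_mul_right h3 _).trans (le_of_eq ?_)
    have h4 : ENNReal.ofReal (2 ^ n / (R / 2 ^ k) ^ n) * ENNReal.ofReal (R / 2 ^ k) =
        ENNReal.ofReal (2 ^ n) * ENNReal.ofReal (R / 2 ^ k / (R / 2 ^ k) ^ n) := by
      rw [← ENNReal.ofReal_mul (by positivity), ← ENNReal.ofReal_mul (by positivity)]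
      congr 1
      ring
    rw [mul_right_comm, h4, mul_assoc]
  have hfin : volume A ≤ ENNReal.ofReal (2 ^ n) * ∑ k ∈ Finset.range K,
      ENNReal.ofReal (R / 2 ^ k / (R / 2 ^ k) ^ n) *
        ∫⁻ y in Metric.ball x (R / 2 ^ k), F y := by
    refine (havg.trans (setLIntegral_Ioc_le_sum_dyadic hR _ K)).trans ?_
    rw [Finset.mul_sum]
    exact Finset.sum_le_sum fun k _ => hscale k
  have hAeq : volume A = ENNReal.ofReal vA := (ENNReal.ofReal_toReal hAtop).symm
  calc (1 : ℝ≥0∞) = ENNReal.ofReal (1 / vA) * volume A := by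
        rw [hAeq, ← ENNReal.ofReal_mul (by positivity), one_div_mul_cancel hvA0.ne']
        simp
    _ ≤ ENNReal.ofReal (1 / vA) * _ := mul_le_mul_right hfin _
    _ = _ := by
        rw [← mul_assoc, ← ENNReal.ofReal_mul (by positivity), one_div_mul_eq_div]

/-! ### Mass bound for equilibrium measures -/

/-- The weight `r ^ (1 + q * (1 - n))` of the scale `r = R / 2 ^ k` in the dyadic Wolff potential,
where `q = 1 / (p - 1)`; in terms of `p` it is `r ^ (-(n - p) / (p - 1))`. -/
noncomputable def scaleWeight (n : ℕ) (q R : ℝ) (k : ℕ) : ℝ :=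
  R / 2 ^ k * (R / 2 ^ k / (R / 2 ^ k) ^ n) ^ q

theorem scaleWeight_pos (n : ℕ) (q : ℝ) {R : ℝ} (hR : 0 < R) (k : ℕ) : 0 < scaleWeight n q R k := by
  unfold scaleWeight
  positivity

/-- Equilibrium masses have total mass at most a constant times the energy of any function that
is at least `1` near the charged points: integrate the pointwise bound of the function, exchange
the order of summation, and apply Hölder's and Wolff's inequalities. -/
theorem exists_sum_le_energy {n : ℕ} (hn : 0 < n) {p : ℝ} (hp : 1 < p) :
    ∃ C : ℝ, 0 < C ∧ ∀ (R : ℝ) (ι : Type) [Fintype ι] (x : ι → EuclideanSpace ℝ (Fin n))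
      (κ : ι → ℕ) (m : ι → ℝ) (u : EuclideanSpace ℝ (Fin n) → ℝ), 0 < R → (∀ i, 0 ≤ m i) →
      (∀ i, 0 < m i → ∑ k ∈ Finset.range (κ i + 1), scaleWeight n (1 / (p - 1)) R k *
          levelMass x κ m k (x i) (2 * (R / 2 ^ k)) ^ (1 / (p - 1)) ≤ 1) →
      ContDiff ℝ ∞ u → tsupport u ⊆ Metric.ball 0 (R / 4) → (∀ i, ‖x i‖ < R / 4) →
      (∀ i, ∀ y ∈ Metric.closedBall (x i) (R / 2 ^ κ i), 1 ≤ u y) →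
      ENNReal.ofReal (∑ i, m i) ≤ ENNReal.ofReal C * ∫⁻ y, ‖fderiv ℝ u y‖ₑ ^ p := by
  set q : ℝ := 1 / (p - 1) with hqdef
  have hp1 : 0 < p - 1 := by linarith
  have hq : 0 < q := by positivity
  have hqp : p * q = q + 1 := by rw [hqdef]; field_simp; ring
  have hconj : p.HolderConjugate (q + 1) := by
    rw [Real.holderConjugate_iff]
    refine ⟨hp, ?_⟩
    rw [← hqp]; field_simp; linarith
  obtain ⟨C₁, hC₁, hpt⟩ := exists_one_le_sum_lintegral_fderiv hn
  obtain ⟨C₂, hC₂, hwolff⟩ := exists_lintegral_dyadicRiesz_rpow_le n hq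
  refine ⟨C₁ ^ p * C₂ ^ (p - 1), by positivity,
    fun R ι _ x κ m u hR hm hpot hu hsupp hx hone => ?_⟩
  have hr : ∀ k : ℕ, 0 < R / 2 ^ k := fun k => by positivity
  set N := Finset.univ.sup κ with hN
  have hκN : ∀ i, κ i ≤ N := fun i => Finset.le_sup (Finset.mem_univ i)
  set F : EuclideanSpace ℝ (Fin n) → ℝ≥0∞ := fun y => ‖fderiv ℝ u y‖ₑ with hF
  have hFm : Measurable F := (hu.continuous_fderiv (by simp)).enorm.measurable
  set J : EuclideanSpace ℝ (Fin n) → ℝ≥0∞ := fun y => ENNReal.ofReal (dyadicRiesz x κ m R N y)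
    with hJ
  have hJm : Measurable J := (measurable_dyadicRiesz x κ m R N).ennreal_ofReal
  set S : ℝ≥0∞ := ENNReal.ofReal (∑ i, m i) with hS
  set M : ℝ≥0∞ := ∫⁻ y, F y ^ p with hM
  have hJF : ∀ y, J y * F y = ∑ k ∈ Finset.range N, ∑ i,
      ENNReal.ofReal (R / 2 ^ k / (R / 2 ^ k) ^ n) * (if k ≤ κ i then ENNReal.ofReal (m i) else 0) *
        (Metric.ball (x i) (R / 2 ^ k)).indicator F y := by
    intro y
    have hnn : ∀ k i, 0 ≤ (Metric.ball (x i) (R / 2 ^ k)).indicator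
        (fun _ => if k ≤ κ i then m i else 0) y := fun k i =>
      indicator_nonneg (fun _ _ => by split_ifs; exacts [hm i, le_rfl]) y
    simp only [hJ, dyadicRiesz]
    rw [ENNReal.ofReal_sum_of_nonneg fun k _ =>
      mul_nonneg (by positivity) (levelMass_nonneg hm _ _ _), Finset.sum_mul]
    refine Finset.sum_congr rfl fun k _ => ?_
    rw [levelMass_eq_sum_indicator, ENNReal.ofReal_mul (by positivity),
      ENNReal.ofReal_sum_of_nonneg fun i _ => hnn k i, Finset.mul_sum, Finset.sum_mul]
    refine Finset.sum_congr rfl fun i _ => ?_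
    simp only [Set.indicator]
    split_ifs <;> simp
  have hint : ∫⁻ y, J y * F y = ∑ k ∈ Finset.range N, ∑ i,
      ENNReal.ofReal (R / 2 ^ k / (R / 2 ^ k) ^ n) * (if k ≤ κ i then ENNReal.ofReal (m i) else 0) *
        ∫⁻ y in Metric.ball (x i) (R / 2 ^ k), F y := by
    simp only [hJF]
    have hmeas : ∀ k i, Measurable fun y =>
        ENNReal.ofReal (R / 2 ^ k / (R / 2 ^ k) ^ n) *
          (if k ≤ κ i then ENNReal.ofReal (m i) else 0) *
          (Metric.ball (x i) (R / 2 ^ k)).indicator F y := fun k i =>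
      (hFm.indicator measurableSet_ball).const_mul _
    rw [lintegral_finsetSum _ fun k _ => Finset.measurable_fun_sum _ fun i _ => hmeas k i]
    refine Finset.sum_congr rfl fun k _ => ?_
    rw [lintegral_finsetSum _ fun i _ => hmeas k i]
    refine Finset.sum_congr rfl fun i _ => ?_
    rw [lintegral_const_mul _ (hFm.indicator measurableSet_ball),
      lintegral_indicator measurableSet_ball]
  have h1 : S ≤ ENNReal.ofReal C₁ * ∫⁻ y, J y * F y := by
    rw [hS, ENNReal.ofReal_sum_of_nonneg fun i _ => hm i, hint, Finset.sum_comm, Finset.mul_sum]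
    refine Finset.sum_le_sum fun i _ => ?_
    have h2 := hpt R u (x i) (κ i) hR hu hsupp (hx i) (hone i)
    calc ENNReal.ofReal (m i) = ENNReal.ofReal (m i) * 1 := (mul_one _).symm
      _ ≤ ENNReal.ofReal (m i) * _ := mul_le_mul_right h2 _
      _ = ENNReal.ofReal C₁ * ∑ k ∈ Finset.range (κ i),
            ENNReal.ofReal (R / 2 ^ k / (R / 2 ^ k) ^ n) *
            (if k ≤ κ i then ENNReal.ofReal (m i) else 0) *
            ∫⁻ y in Metric.ball (x i) (R / 2 ^ k), F y := by
          rw [mul_left_comm, Finset.mul_sum]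
          congr 1
          refine Finset.sum_congr rfl fun k hk => ?_
          rw [if_pos (Finset.mem_range.1 hk).le]
          ring
      _ ≤ _ := mul_le_mul_right (Finset.sum_le_sum_of_subset
          (Finset.range_subset_range.2 (hκN i))) _
  have h2 : ∫⁻ y, J y * F y ≤ (ENNReal.ofReal C₂ * S) ^ (1 / (q + 1)) * M ^ (1 / p) := by
    refine (ENNReal.lintegral_mul_le_Lp_mul_Lq volume hconj.symm hJm.aemeasurable
      hFm.aemeasurable).trans ?_
    refine mul_le_mul_left (ENNReal.rpow_le_rpow ?_ (by positivity)) _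
    rw [hS, ← ENNReal.ofReal_mul hC₂.le]
    exact hwolff R ι x κ m hR hm hpot N
  have h3 : S ^ p ≤ ENNReal.ofReal (C₁ ^ p * C₂ ^ (p - 1)) * M * S ^ (p - 1) := by
    have hp0 : 0 ≤ p := by linarith
    have e1 : 1 / (q + 1) * p = p - 1 := by rw [← hqp, hqdef]; field_simp
    calc S ^ p ≤ (ENNReal.ofReal C₁ *
          ((ENNReal.ofReal C₂ * S) ^ (1 / (q + 1)) * M ^ (1 / p))) ^ p :=
          ENNReal.rpow_le_rpow (h1.trans (mul_le_mul_right h2 _)) hp0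
      _ = _ := by
          rw [ENNReal.mul_rpow_of_nonneg _ _ hp0, ENNReal.mul_rpow_of_nonneg _ _ hp0,
            ← ENNReal.rpow_mul, ← ENNReal.rpow_mul, e1, one_div_mul_cancel (by linarith),
            ENNReal.rpow_one, ENNReal.mul_rpow_of_nonneg _ _ hp1.le,
            ENNReal.ofReal_mul (by positivity), ENNReal.ofReal_rpow_of_nonneg hC₁.le hp0,
            ENNReal.ofReal_rpow_of_nonneg hC₂.le hp1.le]
          ring
  rcases eq_or_ne S 0 with h0 | h0
  · rw [h0]; exact zero_le
  have hStop : S ≠ ⊤ := ENNReal.ofReal_ne_top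
  have e2 : S ^ p = S * S ^ (p - 1) := by
    conv_rhs => rw [← ENNReal.rpow_one S]
    rw [← ENNReal.rpow_mul, one_mul, ← ENNReal.rpow_add _ _ h0 hStop]
    congr 1
    ring
  rw [e2] at h3
  exact (ENNReal.mul_le_mul_iff_left (ENNReal.rpow_pos (pos_iff_ne_zero.2 h0) hStop).ne'
    (ENNReal.rpow_ne_top_of_nonneg hp1.le hStop)).1 h3

/-- Equilibrium measure of finitely many balls inside the set where a test function is at
least `1`. -/
theorem exists_equilibrium_measure {n : ℕ} (hn : 0 < n) {p : ℝ} (hp : 1 < p) :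
    ∃ C : ℝ, 0 < C ∧ ∀ (R : ℝ) (ι : Type) [Fintype ι] (x : ι → EuclideanSpace ℝ (Fin n))
      (κ : ι → ℕ) (u : EuclideanSpace ℝ (Fin n) → ℝ), 0 < R →
      ContDiff ℝ ∞ u → tsupport u ⊆ Metric.ball 0 (R / 4) → (∀ i, ‖x i‖ < R / 4) →
      (∀ i, ∀ y ∈ Metric.closedBall (x i) (R / 2 ^ κ i), 1 ≤ u y) →
      ∃ ν : FiniteMeasure (EuclideanSpace ℝ (Fin n)),
        (ν : Measure (EuclideanSpace ℝ (Fin n))) univ ≤ ENNReal.ofReal C * ∫⁻ y, ‖fderiv ℝ u y‖ₑ ^ p ∧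
        (ν : Measure (EuclideanSpace ℝ (Fin n))) (Metric.closedBall 0 (R / 4))ᶜ = 0 ∧
        ∀ i, 1 ≤ 5 ^ n * ∑ k ∈ Finset.range (κ i + 1),
          ENNReal.ofReal (scaleWeight n (1 / (p - 1)) R k) *
            (ν : Measure (EuclideanSpace ℝ (Fin n))) (Metric.closedBall (x i) (8 * (R / 2 ^ k))) ^ (1 / (p - 1)) := by
  obtain ⟨C, hC, hmass⟩ := exists_sum_le_energy hn hp
  have hp1 : 0 < p - 1 := by linarith
  have hq : 0 < 1 / (p - 1) := by positivity
  refine ⟨C, hC, fun R ι _ x κ u hR hu hsupp hx hone => ?_⟩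
  obtain ⟨m, hm, hlow, hup⟩ := exists_equilibrium_masses hq hR x κ
    (fun k => scaleWeight n (1 / (p - 1)) R k) (fun k => scaleWeight_pos n _ hR k)
  set ν : Measure (EuclideanSpace ℝ (Fin n)) :=
    ∑ i, ENNReal.ofReal (m i) • Measure.dirac (x i) with hν
  have hνA : ∀ A, MeasurableSet A → ν A = ∑ i, ENNReal.ofReal (m i) * A.indicator 1 (x i) := by
    intro A hA
    simp [hν, Measure.finsetSum_apply, Measure.dirac_apply' _ hA]
  have hνuniv : ν univ = ENNReal.ofReal (∑ i, m i) := by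
    rw [hνA _ MeasurableSet.univ, ENNReal.ofReal_sum_of_nonneg fun i _ => hm i]
    simp
  have hfin : IsFiniteMeasure ν := ⟨by rw [hνuniv]; exact ENNReal.ofReal_lt_top⟩
  refine ⟨⟨ν, hfin⟩, ?_, ?_, fun i => ?_⟩
  · show ν univ ≤ _
    rw [hνuniv]
    exact hmass R ι x κ m u hR hm hup hu hsupp hx hone
  · show ν _ = 0
    rw [hνA _ Metric.isClosed_closedBall.measurableSet.compl]
    refine Finset.sum_eq_zero fun i _ => ?_
    have : x i ∉ (Metric.closedBall (0 : EuclideanSpace ℝ (Fin n)) (R / 4))ᶜ := by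
      simpa using (hx i).le
    rw [indicator_of_notMem this, mul_zero]
  · show 1 ≤ 5 ^ n * ∑ k ∈ Finset.range (κ i + 1),
      ENNReal.ofReal (scaleWeight n (1 / (p - 1)) R k) *
        ν (Metric.closedBall (x i) (8 * (R / 2 ^ k))) ^ (1 / (p - 1))
    have hsum0 : ∀ k : ℕ, 0 ≤ ∑ j with dist (x j) (x i) < 8 * (R / 2 ^ k), m j :=
      fun k => Finset.sum_nonneg fun j _ => hm j
    have h1 := ENNReal.ofReal_le_ofReal (hlow i)
    rw [ENNReal.ofReal_one, ENNReal.ofReal_mul (by positivity), ENNReal.ofReal_sum_of_nonneg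
      fun k _ => mul_nonneg (scaleWeight_pos n _ hR k).le (Real.rpow_nonneg (hsum0 k) _)] at h1
    refine h1.trans ?_
    refine mul_le_mul' (le_of_eq ?_) (Finset.sum_le_sum fun k _ => ?_)
    · rw [ENNReal.ofReal_pow (by norm_num)]; simp
    · rw [ENNReal.ofReal_mul (scaleWeight_pos n _ hR k).le,
        ← ENNReal.ofReal_rpow_of_nonneg (hsum0 k) hq.le]
      refine mul_le_mul_right (ENNReal.rpow_le_rpow ?_ hq.le) _
      rw [hνA _ Metric.isClosed_closedBall.measurableSet,
        ENNReal.ofReal_sum_of_nonneg fun j _ => hm j, Finset.sum_filter]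
      refine Finset.sum_le_sum fun j _ => ?_
      split_ifs with h
      · rw [indicator_of_mem (by simpa using h.le)]; simp
      · exact zero_le

/-! ### Measures with large Wolff potential on an open set -/

/-- The scale `R / 2 ^ k` contributes to the integral defining the Wolff potential through the
radii between `8 * (R / 2 ^ k)` and `16 * (R / 2 ^ k)`; these intervals are disjoint. -/
theorem sum_scaleWeight_mul_rpow_le_wolffPotential {n : ℕ} {p : ℝ} (hp : 1 < p) (hpn : p ≤ n)
    (μ : Measure (EuclideanSpace ℝ (Fin n))) (x : EuclideanSpace ℝ (Fin n)) {R : ℝ} (hR : 0 < R)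
    (N : ℕ) :
    ∑ k ∈ Finset.range N, ENNReal.ofReal (scaleWeight n (1 / (p - 1)) R k) *
        μ (Metric.closedBall x (8 * (R / 2 ^ k))) ^ (1 / (p - 1)) ≤
      ENNReal.ofReal (2 * (16 ^ ((n : ℝ) - p)) ^ (1 / (p - 1))) * wolffPotential p μ x (16 * R) := by
  have hp1 : 0 < p - 1 := by linarith
  set q : ℝ := 1 / (p - 1) with hqdef
  have hq : 0 < q := by positivity
  have hpq : (p - 1) * q = 1 := by rw [hqdef]; field_simp
  have hr : ∀ k : ℕ, 0 < R / 2 ^ k := fun k => by positivity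
  set f : ℝ → ℝ≥0∞ := fun t =>
    (μ (Metric.ball x t) / ENNReal.ofReal (t ^ ((n : ℝ) - p))) ^ q / ENNReal.ofReal t with hf
  set I : ℕ → Set ℝ := fun k => Ioo (8 * (R / 2 ^ k)) (16 * (R / 2 ^ k)) with hI
  have hone : ∀ k : ℕ, ENNReal.ofReal (scaleWeight n q R k) *
      μ (Metric.closedBall x (8 * (R / 2 ^ k))) ^ q ≤
      ENNReal.ofReal (2 * (16 ^ ((n : ℝ) - p)) ^ q) * ∫⁻ t in I k, f t := by
    intro k
    set r := R / 2 ^ k with hrk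
    have hr0 : 0 < r := hr k
    set B := μ (Metric.closedBall x (8 * r)) with hB
    have hlow : (B / ENNReal.ofReal ((16 * r) ^ ((n : ℝ) - p))) ^ q / ENNReal.ofReal (16 * r) *
        ENNReal.ofReal (8 * r) ≤ ∫⁻ t in I k, f t := by
      have : volume (I k) = ENNReal.ofReal (8 * r) := by
        rw [hI, Real.volume_Ioo]; congr 1; ring
      rw [← this, ← setLIntegral_const]
      refine setLIntegral_mono' measurableSet_Ioo fun t ht => ?_
      have ht0 : 0 < t := lt_trans (by positivity) ht.1
      refine ENNReal.div_le_div (ENNReal.rpow_le_rpow (ENNReal.div_le_div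
        (measure_mono (Metric.closedBall_subset_ball ht.1)) (ENNReal.ofReal_le_ofReal
        (Real.rpow_le_rpow ht0.le ht.2.le (by linarith)))) hq.le)
        (ENNReal.ofReal_le_ofReal ht.2.le)
    refine le_trans (le_of_eq ?_) (mul_le_mul_right hlow _)
    have hw : scaleWeight n q R k = (r ^ ((n : ℝ) - p))⁻¹ ^ q := by
      rw [scaleWeight, ← hrk, ← Real.rpow_natCast, Real.div_rpow hr0.le (by positivity),
        ← Real.rpow_neg hr0.le, ← Real.rpow_mul hr0.le, ← Real.rpow_mul hr0.le,
        ← Real.rpow_sub hr0]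
      calc r * r ^ (q - n * q) = r ^ (1 + (q - n * q)) := by
            rw [Real.rpow_add hr0, Real.rpow_one]
        _ = _ := by
            congr 1
            linear_combination -hpq
    have hA : 0 < (16 * r) ^ ((n : ℝ) - p) := by positivity
    rw [hw, div_eq_mul_inv, div_eq_mul_inv, ENNReal.mul_rpow_of_nonneg _ _ hq.le,
      ← ENNReal.ofReal_inv_of_pos hA, ENNReal.ofReal_rpow_of_pos (by positivity),
      ← ENNReal.ofReal_inv_of_pos (by positivity)]
    have e : ENNReal.ofReal ((r ^ ((n : ℝ) - p))⁻¹ ^ q) =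
        ENNReal.ofReal (2 * (16 ^ ((n : ℝ) - p)) ^ q) *
          (ENNReal.ofReal (((16 * r) ^ ((n : ℝ) - p))⁻¹ ^ q) * ENNReal.ofReal ((16 * r)⁻¹) *
            ENNReal.ofReal (8 * r)) := by
      rw [← ENNReal.ofReal_mul (by positivity), ← ENNReal.ofReal_mul (by positivity),
        ← ENNReal.ofReal_mul (by positivity)]
      congr 1
      rw [Real.mul_rpow (by norm_num) hr0.le, mul_inv,
        Real.mul_rpow (by positivity) (by positivity),
        Real.inv_rpow (x := (16 : ℝ) ^ ((n : ℝ) - p)) (by positivity)]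
      have : ((16 : ℝ) ^ ((n : ℝ) - p)) ^ q ≠ 0 := by positivity
      field_simp
      norm_num
    rw [e]
    ring
  refine (Finset.sum_le_sum fun k _ => hone k).trans ?_
  rw [← Finset.mul_sum]
  refine mul_le_mul_right ?_ _
  have hdisj : Set.PairwiseDisjoint (↑(Finset.range N)) I := by
    have hlt : ∀ k l : ℕ, k < l → Disjoint (I k) (I l) := by
      intro k l hkl
      rw [Set.disjoint_left]
      intro t htk htl
      have h1 : R / 2 ^ l ≤ R / 2 ^ (k + 1) := by
        have : k + 1 ≤ l := hkl
        gcongr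
        norm_num
      have h2 : R / 2 ^ (k + 1) = R / 2 ^ k / 2 := by rw [pow_succ]; field_simp
      have h3 := htk.1
      have h4 := htl.2
      linarith
    intro k _ l _ hkl
    rcases lt_or_gt_of_ne hkl with h | h
    · exact hlt k l h
    · exact (hlt l k h).symm
  rw [← lintegral_biUnion_finset hdisj fun k _ => measurableSet_Ioo]
  refine lintegral_mono_set ?_
  refine iUnion₂_subset fun k _ t ht => ⟨lt_trans (by have := hr k; positivity) ht.1, ?_⟩
  have : R / 2 ^ k ≤ R := div_le_self hR.le (one_le_pow₀ (by norm_num))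
  linarith [ht.2]

/-- If every compact subset of an open set `G` carries a test function of energy at most `M`, then
there is a measure of mass at most a multiple of `M` whose Wolff potential is bounded below on `G`.
It is a weak limit of equilibrium measures of finite unions of balls in `G`. At a point of `G` only
the finitely many scales larger than the distance to the complement of `G` are used, so the lower
bound passes to the limit. -/
theorem exists_measure_one_le_wolffPotential {n : ℕ} {p : ℝ} (hp : 1 < p) (hpn : p ≤ n) :
    ∃ C : ℝ, 0 < C ∧ ∀ (R : ℝ) (G : Set (EuclideanSpace ℝ (Fin n))) (M : ℝ≥0∞), 0 < R →
      IsOpen G → G ⊆ Metric.ball 0 (R / 4) → M ≠ ⊤ →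
      (∀ K, IsCompact K → K ⊆ G → ∃ u : EuclideanSpace ℝ (Fin n) → ℝ, ContDiff ℝ ∞ u ∧
        tsupport u ⊆ Metric.ball 0 (R / 4) ∧ (∀ y ∈ K, 1 ≤ u y) ∧
        ∫⁻ y, ‖fderiv ℝ u y‖ₑ ^ p ≤ M) →
      ∃ μ : Measure (EuclideanSpace ℝ (Fin n)), μ univ ≤ ENNReal.ofReal C * M ∧
        ∀ x ∈ G, 1 ≤ ENNReal.ofReal C * wolffPotential p μ x (16 * R) := by
  have hn : 0 < n := by
    have : (0 : ℝ) < n := by linarith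
    exact_mod_cast this
  have hp1 : 0 < p - 1 := by linarith
  have hq : 0 < 1 / (p - 1) := by positivity
  obtain ⟨C₁, hC₁, heq⟩ := exists_equilibrium_measure hn hp
  set C₂ : ℝ := 5 ^ n * (2 * (16 ^ ((n : ℝ) - p)) ^ (1 / (p - 1))) with hC₂
  have hC₂0 : 0 < C₂ := by positivity
  refine ⟨max C₁ C₂, by positivity, fun R G M hR hG hGR hM hcap => ?_⟩
  have hr : ∀ k : ℕ, 0 < R / 2 ^ k := fun k => by positivity
  have hball : ∀ x : G, ∃ k : ℕ, Metric.closedBall (x : EuclideanSpace ℝ (Fin n)) (R / 2 ^ k) ⊆ G := by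
    intro x
    obtain ⟨ε, hε, hsub⟩ := Metric.isOpen_iff.1 hG x x.2
    obtain ⟨k, hk⟩ := exists_pow_lt_of_lt_one (div_pos hε hR) (by norm_num : (1 / 2 : ℝ) < 1)
    refine ⟨k, (Metric.closedBall_subset_ball ?_).trans hsub⟩
    rw [lt_div_iff₀ hR] at hk
    calc R / 2 ^ k = (1 / 2) ^ k * R := by rw [one_div, inv_pow]; field_simp
      _ < ε := hk
  choose κ hκ using hball
  -- the equilibrium measures of the balls around finitely many points of `G`
  have hfin : ∀ T : Finset G, ∃ ν : FiniteMeasure (EuclideanSpace ℝ (Fin n)),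
      (ν : Measure (EuclideanSpace ℝ (Fin n))) univ ≤ ENNReal.ofReal C₁ * M ∧
      (ν : Measure (EuclideanSpace ℝ (Fin n))) (Metric.closedBall 0 (R / 4))ᶜ = 0 ∧
      ∀ x ∈ T, 1 ≤ 5 ^ n * ∑ k ∈ Finset.range (κ x + 1),
        ENNReal.ofReal (scaleWeight n (1 / (p - 1)) R k) *
          (ν : Measure (EuclideanSpace ℝ (Fin n))) (Metric.closedBall x (8 * (R / 2 ^ k))) ^
            (1 / (p - 1)) := by
    intro T
    obtain ⟨u, hu, hsupp, hone, hen⟩ := hcap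
      (⋃ x ∈ T, Metric.closedBall (x : EuclideanSpace ℝ (Fin n)) (R / 2 ^ κ x))
      (T.isCompact_biUnion fun x _ => isCompact_closedBall _ _)
      (iUnion₂_subset fun x _ => hκ x)
    obtain ⟨ν, h1, h2, h3⟩ := heq R (Fin T.card) (fun i => ((T.equivFin.symm i : G) : _))
      (fun i => κ (T.equivFin.symm i)) u hR hu hsupp
      (fun i => by simpa using hGR (T.equivFin.symm i : G).2)
      (fun i y hy => hone y (mem_iUnion₂.2 ⟨T.equivFin.symm i, (T.equivFin.symm i).2, hy⟩))
    refine ⟨ν, h1.trans (mul_le_mul_right hen _), h2, fun x hx => ?_⟩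
    simpa using h3 (T.equivFin ⟨x, hx⟩)
  choose ν hν1 hν2 hν3 using hfin
  set L : Ultrafilter (Finset G) := Ultrafilter.of atTop with hL
  have hLat : (L : Filter (Finset G)) ≤ atTop := Ultrafilter.of_le _
  have hmassfin : ENNReal.ofReal C₁ * M ≠ ⊤ := ENNReal.mul_ne_top ENNReal.ofReal_ne_top hM
  obtain ⟨μ, ⟨hμ1, -⟩, hμL⟩ := (isCompact_setOfPred_finiteMeasure_le_of_isCompact
    (ENNReal.ofReal C₁ * M).toNNReal
    (isCompact_closedBall (0 : EuclideanSpace ℝ (Fin n)) (R / 4))).ultrafilter_le_nhds'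
    (L.map ν) (by
      refine Filter.mem_map.2 (Filter.univ_mem' fun T => ?_)
      refine ⟨?_, ?_⟩
      · rw [← ENNReal.coe_le_coe, ENNReal.coe_toNNReal hmassfin, FiniteMeasure.ennreal_mass]
        exact hν1 T
      · rw [FiniteMeasure.null_iff_toMeasure_null]
        exact hν2 T)
  have hlim : Tendsto ν (L : Filter (Finset G)) (𝓝 μ) := hμL
  refine ⟨μ, ?_, fun x hx => ?_⟩
  · rw [← ENNReal.coe_le_coe, ENNReal.coe_toNNReal hmassfin, FiniteMeasure.ennreal_mass] at hμ1
    exact hμ1.trans (mul_le_mul_left (ENNReal.ofReal_le_ofReal (le_max_left _ _)) _)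
  · have hconv : ∀ k : ℕ, ∃ l ≤ (μ : Measure (EuclideanSpace ℝ (Fin n)))
        (Metric.closedBall x (8 * (R / 2 ^ k))),
        Tendsto (fun T => (ν T : Measure (EuclideanSpace ℝ (Fin n)))
          (Metric.closedBall x (8 * (R / 2 ^ k)))) L (𝓝 l) := by
      intro k
      obtain ⟨l, -, hl⟩ := isCompact_univ.ultrafilter_le_nhds' (L.map fun T =>
        (ν T : Measure (EuclideanSpace ℝ (Fin n))) (Metric.closedBall x (8 * (R / 2 ^ k))))
        Filter.univ_mem
      have hl' : Tendsto (fun T => (ν T : Measure (EuclideanSpace ℝ (Fin n)))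
          (Metric.closedBall x (8 * (R / 2 ^ k)))) L (𝓝 l) := hl
      refine ⟨l, ?_, hl'⟩
      rw [← hl'.limsup_eq]
      exact FiniteMeasure.limsup_measure_closed_le_of_tendsto hlim Metric.isClosed_closedBall
    choose l hlμ hl using hconv
    have hsum : Tendsto (fun T => 5 ^ n * ∑ k ∈ Finset.range (κ ⟨x, hx⟩ + 1),
        ENNReal.ofReal (scaleWeight n (1 / (p - 1)) R k) *
          (ν T : Measure (EuclideanSpace ℝ (Fin n))) (Metric.closedBall x (8 * (R / 2 ^ k))) ^
            (1 / (p - 1))) L (𝓝 (5 ^ n * ∑ k ∈ Finset.range (κ ⟨x, hx⟩ + 1),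
        ENNReal.ofReal (scaleWeight n (1 / (p - 1)) R k) * l k ^ (1 / (p - 1)))) := by
      refine ENNReal.Tendsto.const_mul (tendsto_finsetSum _ fun k _ => ?_) (Or.inr (by simp))
      exact ENNReal.Tendsto.const_mul ((hl k).ennrpow_const _) (Or.inr ENNReal.ofReal_ne_top)
    have hev : ∀ᶠ T in (L : Filter (Finset G)), (⟨x, hx⟩ : G) ∈ T := by
      refine hLat ?_
      filter_upwards [eventually_ge_atTop ({⟨x, hx⟩} : Finset G)] with T hT
      exact Finset.singleton_subset_iff.1 hT
    have hge := ge_of_tendsto hsum (hev.mono fun T hT => hν3 T ⟨x, hx⟩ hT)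
    refine hge.trans ?_
    calc _ ≤ 5 ^ n * ∑ k ∈ Finset.range (κ ⟨x, hx⟩ + 1),
            ENNReal.ofReal (scaleWeight n (1 / (p - 1)) R k) *
              (μ : Measure (EuclideanSpace ℝ (Fin n))) (Metric.closedBall x (8 * (R / 2 ^ k))) ^
                (1 / (p - 1)) := by
          gcongr with k _
          exact hlμ k
      _ ≤ 5 ^ n * (ENNReal.ofReal (2 * (16 ^ ((n : ℝ) - p)) ^ (1 / (p - 1))) *
            wolffPotential p μ x (16 * R)) :=
          mul_le_mul_right (sum_scaleWeight_mul_rpow_le_wolffPotential hp hpn _ x hR _) _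
      _ = ENNReal.ofReal C₂ * wolffPotential p μ x (16 * R) := by
          rw [← mul_assoc, hC₂, ENNReal.ofReal_mul (p := 5 ^ n) (by positivity),
            ENNReal.ofReal_pow (by norm_num), ENNReal.ofReal_ofNat]
      _ ≤ _ := mul_le_mul_left (ENNReal.ofReal_le_ofReal (le_max_right _ _)) _

/-! ### Capacity and Wolff potentials -/

theorem wolffPotential_mono_radius {n : ℕ} (p : ℝ) (μ : Measure (EuclideanSpace ℝ (Fin n)))
    (x : EuclideanSpace ℝ (Fin n)) {r s : ℝ} (h : r ≤ s) :
    wolffPotential p μ x r ≤ wolffPotential p μ x s :=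
  lintegral_mono_set (Ioo_subset_Ioo_right h)

theorem wolffPotential_mono_measure {n : ℕ} {p : ℝ} (hp : 1 < p)
    {μ ν : Measure (EuclideanSpace ℝ (Fin n))} (h : μ ≤ ν) (x : EuclideanSpace ℝ (Fin n)) (r : ℝ) :
    wolffPotential p μ x r ≤ wolffPotential p ν x r := by
  have hq : 0 ≤ 1 / (p - 1) := one_div_nonneg.2 (by linarith)
  exact lintegral_mono fun t => ENNReal.div_le_div_right
    (ENNReal.rpow_le_rpow (ENNReal.div_le_div_right (h _) _) hq) _

theorem wolffPotential_smul {n : ℕ} {p : ℝ} (hp : 1 < p) {c : ℝ≥0∞} (hc : c ≠ ⊤)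
    (μ : Measure (EuclideanSpace ℝ (Fin n))) (x : EuclideanSpace ℝ (Fin n)) (r : ℝ) :
    wolffPotential p (c • μ) x r = c ^ (1 / (p - 1)) * wolffPotential p μ x r := by
  have hq : 0 ≤ 1 / (p - 1) := one_div_nonneg.2 (by linarith)
  unfold wolffPotential
  rw [← lintegral_const_mul' _ _ (ENNReal.rpow_ne_top_of_nonneg hq hc)]
  refine lintegral_congr fun t => ?_
  rw [Measure.smul_apply, smul_eq_mul, mul_div_assoc, ENNReal.mul_rpow_of_nonneg _ _ hq,
    mul_div_assoc]

theorem lintegral_fderiv_rpow_eq_pEnergy {n : ℕ} {p : ℝ} (hp : 0 < p)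
    {Ω : Set (EuclideanSpace ℝ (Fin n))} {u : EuclideanSpace ℝ (Fin n) → ℝ}
    (hu : tsupport u ⊆ Ω) : ∫⁻ y, ‖fderiv ℝ u y‖ₑ ^ p = pEnergy p Ω u := by
  unfold pEnergy
  refine (setLIntegral_eq_of_support_subset ?_).symm
  intro y hy
  by_contra hyΩ
  refine hy ?_
  have : fderiv ℝ u y = 0 := by
    by_contra h
    exact hyΩ (hu (support_fderiv_subset ℝ h))
  show ‖fderiv ℝ u y‖ₑ ^ p = 0
  rw [← ofReal_norm, this, norm_zero, ENNReal.ofReal_zero, ENNReal.zero_rpow_of_pos hp]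

/-- A set of small capacity in a dyadic annulus is contained in the set where the Wolff potential
of a measure of comparably small mass is bounded below. The constant does not depend on the
annulus. -/
theorem exists_measure_of_pCap_lt {n : ℕ} {p : ℝ} (hp : 1 < p) (hpn : p ≤ n) :
    ∃ C : ℝ, 0 < C ∧ ∀ (i : ℕ) (F : Set (EuclideanSpace ℝ (Fin n))) (M : ℝ≥0∞), M ≠ ⊤ →
      pCap p F (openAnnulus 0 (i + 1)) < M →
      ∃ μ : Measure (EuclideanSpace ℝ (Fin n)), μ univ ≤ ENNReal.ofReal C * M ∧
        ∀ x ∈ F, 1 ≤ ENNReal.ofReal C * wolffPotential p μ x 128 := by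
  obtain ⟨C, hC, h⟩ := exists_measure_one_le_wolffPotential (n := n) hp hpn
  refine ⟨C, hC, fun i F M hM hcap => ?_⟩
  simp only [pCap, iInf_lt_iff] at hcap
  obtain ⟨G, ⟨hG, hFG, hGΩ⟩, hcap⟩ := hcap
  -- the annulus lies in the ball of radius `R / 4` with `R = 8 * ρ`, and `16 * R ≤ 128`
  set ρ : ℝ := (1 / 2) ^ i with hρ
  have hρ0 : 0 < ρ := by positivity
  have hρ1 : ρ ≤ 1 := pow_le_one₀ (by norm_num) (by norm_num)
  have hrad : (2 : ℝ) ^ (-((i + 1 : ℕ) : ℤ) + 2) = 8 * ρ / 4 := by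
    rw [zpow_add₀ (by norm_num), zpow_neg, zpow_natCast, pow_succ, hρ, one_div, inv_pow]
    norm_num
    ring
  have hΩ : openAnnulus (0 : EuclideanSpace ℝ (Fin n)) (i + 1) ⊆ Metric.ball 0 (8 * ρ / 4) := by
    intro y hy
    have := hy.2
    rw [hrad, sub_zero] at this
    simpa using this
  obtain ⟨μ, hμ, hW⟩ := h (8 * ρ) G M (by positivity) hG (hGΩ.trans hΩ) hM (fun K hK hKG => by
    have hlt : pCapCompact p K (openAnnulus 0 (i + 1)) < M :=
      (le_iSup₂_of_le K ⟨hK, hKG⟩ le_rfl).trans_lt hcap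
    simp only [pCapCompact, iInf_lt_iff] at hlt
    obtain ⟨u, hu, hen⟩ := hlt
    refine ⟨u, hu.smooth, hu.support_subset.trans hΩ, hu.one_le, ?_⟩
    rw [lintegral_fderiv_rpow_eq_pEnergy (by linarith) hu.support_subset]
    exact hen.le)
  refine ⟨μ, hμ, fun x hx => (hW x (hFG hx)).trans (mul_le_mul_right ?_ _)⟩
  exact wolffPotential_mono_radius p μ x (by linarith)

/-- The capacity of a sphere of radius `r` in the concentric ball of radius `2 * r` is at most a
constant times `r ^ (n - p)`, by scaling a fixed cut-off function. -/
theorem exists_pCap_sphere_le (n : ℕ) {p : ℝ} (hp : 0 < p) :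
    ∃ C : ℝ, 0 < C ∧ ∀ r : ℝ, 0 < r →
      pCap p (Metric.sphere (0 : EuclideanSpace ℝ (Fin n)) r) (Metric.ball 0 (r * 2)) ≤
        ENNReal.ofReal (C * r ^ ((n : ℝ) - p)) := by
  let φ : ContDiffBump (0 : EuclideanSpace ℝ (Fin n)) := ⟨1, 3 / 2, by norm_num, by norm_num⟩
  have hφs : ContDiff ℝ ∞ φ := φ.contDiff
  obtain ⟨L, hL⟩ := (hφs.continuous_fderiv (by simp)).bounded_above_of_compact_support
    (φ.hasCompactSupport.fderiv (𝕜 := ℝ))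
  have hL0 : 0 ≤ L := (norm_nonneg _).trans (hL 0)
  set v : ℝ := (volume (Metric.ball (0 : EuclideanSpace ℝ (Fin n)) 1)).toReal with hv
  have hv0 : 0 ≤ v := ENNReal.toReal_nonneg
  refine ⟨L ^ p * 2 ^ n * v + 1, by positivity, fun r hr => ?_⟩
  rw [pCap_eq_pCapCompact hp.le (isCompact_sphere _ _) Metric.isOpen_ball
    (fun y hy => by
      have : ‖y‖ = r := by simpa using hy
      simp [this]; linarith)]
  set u : EuclideanSpace ℝ (Fin n) → ℝ := fun y => φ (r⁻¹ • y) with hu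
  have hsupp : tsupport u ⊆ Metric.closedBall 0 (r * (3 / 2)) := by
    refine closure_minimal (fun y hy => ?_) Metric.isClosed_closedBall
    have h1 : r⁻¹ • y ∈ Function.support φ := hy
    rw [φ.support_eq, mem_ball_zero_iff, norm_smul, Real.norm_of_nonneg (by positivity),
      ← div_eq_inv_mul, div_lt_iff₀ hr] at h1
    have h2 : ‖y‖ < 3 / 2 * r := h1
    rw [mem_closedBall_zero_iff]
    linarith
  have hadm : IsCapAdmissible (Metric.sphere (0 : EuclideanSpace ℝ (Fin n)) r)
      (Metric.ball 0 (r * 2)) u := by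
    refine ⟨hφs.comp (by fun_prop), ?_, ?_, fun y hy => ?_⟩
    · exact (isCompact_closedBall _ _).of_isClosed_subset (isClosed_tsupport u) hsupp
    · exact hsupp.trans (Metric.closedBall_subset_ball (by linarith))
    · refine (φ.one_of_mem_closedBall ?_).ge
      have h1 : ‖y‖ = r := by simpa using hy
      rw [mem_closedBall_zero_iff, norm_smul, Real.norm_of_nonneg (by positivity), h1,
        inv_mul_cancel₀ hr.ne']
  refine (iInf₂_le u hadm).trans ?_
  have hder : ∀ y, ‖fderiv ℝ u y‖ₑ ^ p ≤ ENNReal.ofReal ((r⁻¹ * L) ^ p) := by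
    intro y
    have h1 : fderiv ℝ u y = r⁻¹ • fderiv ℝ φ (r⁻¹ • y) := by
      have := fderiv_comp_smul (𝕜 := ℝ) (f := φ) (x := y) r⁻¹
      simpa [hu] using this
    rw [h1, ← ofReal_norm, norm_smul, Real.norm_of_nonneg (by positivity),
      ENNReal.ofReal_rpow_of_nonneg (by positivity) hp.le]
    refine ENNReal.ofReal_le_ofReal (Real.rpow_le_rpow (by positivity) ?_ hp.le)
    exact mul_le_mul_of_nonneg_left (hL _) (by positivity)
  calc pEnergy p (Metric.ball 0 (r * 2)) u
      ≤ ∫⁻ _ in Metric.ball (0 : EuclideanSpace ℝ (Fin n)) (r * 2),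
          ENNReal.ofReal ((r⁻¹ * L) ^ p) := lintegral_mono fun y => hder y
    _ = ENNReal.ofReal (L ^ p * 2 ^ n * v * r ^ ((n : ℝ) - p)) := by
        rw [setLIntegral_const, Measure.addHaar_ball_of_pos _ _ (by positivity),
          finrank_euclideanSpace_fin, ← ENNReal.ofReal_toReal
            (measure_ball_lt_top (μ := volume) (x := (0 : EuclideanSpace ℝ (Fin n))) (r := 1)).ne,
          ← hv, ← ENNReal.ofReal_mul (by positivity), ← ENNReal.ofReal_mul (by positivity)]
        congr 1
        rw [Real.mul_rpow (by positivity) hL0, Real.inv_rpow hr.le, Real.rpow_sub hr,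
          Real.rpow_natCast, mul_pow]
        ring
    _ ≤ _ := by
        refine ENNReal.ofReal_le_ofReal ?_
        have : 0 ≤ r ^ ((n : ℝ) - p) := by positivity
        linarith

/-! ### Assembling the annuli -/

/-- A convergent series of nonnegative terms still converges after multiplication by suitable
weights tending to infinity: `a i` counts the tails, taken along a sparse sequence of starting
indices, that contain the index `i`. -/
theorem exists_tendsto_atTop_tsum_mul_ne_top (b : ℕ → ℝ≥0∞) (hb : ∑' i, b i ≠ ⊤) :
    ∃ a : ℕ → ℕ, Tendsto a atTop atTop ∧ ∑' i, (a i : ℝ≥0∞) * b i ≠ ⊤ := by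
  have htail : ∀ k : ℕ, ∃ N : ℕ, ∑' i, (if N ≤ i then b i else 0) ≤ 2⁻¹ ^ k := by
    intro k
    have h1 := ENNReal.tendsto_sum_nat_add b hb
    have hpos : (0 : ℝ≥0∞) < 2⁻¹ ^ k := ENNReal.pow_pos (by simp) k
    obtain ⟨N, hN⟩ := (h1.eventually (gt_mem_nhds hpos)).exists
    refine ⟨N, le_trans (le_of_eq ?_) hN.le⟩
    rw [← ENNReal.summable.sum_add_tsum_nat_add' (k := N)]
    rw [Finset.sum_eq_zero fun i hi => if_neg (by simpa using hi), zero_add]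
    exact tsum_congr fun i => if_pos (Nat.le_add_left _ _)
  choose N hN using htail
  refine ⟨fun i => ((Finset.range (i + 1)).filter fun k => N k ≤ i).card, ?_, ?_⟩
  · refine tendsto_atTop.2 fun K => ?_
    filter_upwards [eventually_ge_atTop (K + (Finset.range K).sup N)] with i hi
    calc K = (Finset.range K).card := (Finset.card_range K).symm
      _ ≤ _ := by
        refine Finset.card_le_card fun k hk => ?_
        have h1 : N k ≤ (Finset.range K).sup N := Finset.le_sup hk
        simp only [Finset.mem_range, Finset.mem_filter] at hk ⊢
        omega
  · refine ne_top_of_le_ne_top (b := ∑' k : ℕ, (2⁻¹ : ℝ≥0∞) ^ k) ?_ ?_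
    · rw [ENNReal.tsum_geometric]
      simp
    · calc _ ≤ ∑' i, ∑' k, (if N k ≤ i then b i else 0) := by
            refine ENNReal.tsum_le_tsum fun i => ?_
            refine le_trans (le_of_eq ?_) (ENNReal.sum_le_tsum (Finset.range (i + 1)))
            rw [← Finset.sum_filter, Finset.sum_const, nsmul_eq_mul]
        _ = ∑' k, ∑' i, (if N k ≤ i then b i else 0) := ENNReal.tsum_comm
        _ ≤ _ := ENNReal.tsum_le_tsum hN

/-- If the weighted capacities `w i * cap (F i)` are summable, a single finite measure has Wolff
potential at least `c * (a i * w i) ^ (1 / (p - 1))` on every `F i`, with `a i → ∞`. -/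
theorem exists_finiteMeasure_wolffPotential_ge {n : ℕ} {p : ℝ} (hp : 1 < p) (hpn : p ≤ n)
    (F : ℕ → Set (EuclideanSpace ℝ (Fin n))) (w : ℕ → ℝ) (hw : ∀ i, 0 < w i)
    (hsum : ∑' i, ENNReal.ofReal (w i) * pCap p (F i) (openAnnulus 0 (i + 1)) ≠ ⊤) :
    ∃ μ : Measure (EuclideanSpace ℝ (Fin n)), IsFiniteMeasure μ ∧
      ∃ a : ℕ → ℕ, Tendsto a atTop atTop ∧ ∃ c : ℝ, 0 < c ∧ ∀ i, ∀ x ∈ F i,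
        ENNReal.ofReal (c * (a i * w i) ^ (1 / (p - 1))) ≤ wolffPotential p μ x 128 := by
  obtain ⟨C, hC, hkey⟩ := exists_measure_of_pCap_lt (n := n) hp hpn
  have hq : 0 ≤ 1 / (p - 1) := one_div_nonneg.2 (by linarith)
  set cap : ℕ → ℝ≥0∞ := fun i => pCap p (F i) (openAnnulus 0 (i + 1)) with hcap
  have hwpos : ∀ i, ENNReal.ofReal (w i) ≠ 0 := fun i => (ENNReal.ofReal_pos.2 (hw i)).ne'
  have hcapfin : ∀ i, cap i ≠ ⊤ := by
    intro i h
    have h1 := ENNReal.ne_top_of_tsum_ne_top hsum i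
    exact h1 (by simp only [hcap] at h; rw [h, ENNReal.mul_top (hwpos i)])
  -- enlarge the capacities slightly, so that sets of capacity zero need no separate treatment
  set M : ℕ → ℝ≥0∞ := fun i => cap i + 2⁻¹ ^ i / ENNReal.ofReal (w i) with hM
  have hMfin : ∀ i, M i ≠ ⊤ := fun i => ENNReal.add_ne_top.2
    ⟨hcapfin i, (ENNReal.div_lt_top (ENNReal.pow_ne_top (by simp)) (hwpos i)).ne⟩
  have hlt : ∀ i, cap i < M i := fun i => ENNReal.lt_add_right (hcapfin i)
    (ENNReal.div_pos (ENNReal.pow_pos (by simp) i).ne' ENNReal.ofReal_ne_top).ne'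
  have hMsum : ∑' i, ENNReal.ofReal (w i) * M i ≠ ⊤ := by
    have h1 : ∀ i, ENNReal.ofReal (w i) * M i = ENNReal.ofReal (w i) * cap i + 2⁻¹ ^ i := by
      intro i
      rw [hM, mul_add, ENNReal.mul_div_cancel (hwpos i) ENNReal.ofReal_ne_top]
    simp only [h1]
    rw [ENNReal.tsum_add, ENNReal.tsum_geometric]
    exact ENNReal.add_ne_top.2 ⟨hsum, by simp⟩
  obtain ⟨a, ha, hasum⟩ := exists_tendsto_atTop_tsum_mul_ne_top _ hMsum
  choose ν hν hW using fun i => hkey i (F i) (M i) (hMfin i) (hlt i)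
  have hcoef : ∀ i, ENNReal.ofReal (a i * w i) = (a i : ℝ≥0∞) * ENNReal.ofReal (w i) := by
    intro i
    rw [ENNReal.ofReal_mul (by positivity), ENNReal.ofReal_natCast]
  refine ⟨Measure.sum fun i => ENNReal.ofReal (a i * w i) • ν i, ⟨?_⟩, a, ha, 1 / C,
    by positivity, fun i x hx => ?_⟩
  · rw [Measure.sum_apply _ MeasurableSet.univ]
    refine lt_of_le_of_lt (ENNReal.tsum_le_tsum (g := fun i =>
      ENNReal.ofReal C * ((a i : ℝ≥0∞) * (ENNReal.ofReal (w i) * M i))) fun i => ?_) ?_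
    · rw [Measure.smul_apply, smul_eq_mul, hcoef]
      refine (mul_le_mul_right (hν i) _).trans (le_of_eq ?_)
      ring
    · rw [ENNReal.tsum_mul_left]
      exact (ENNReal.mul_ne_top ENNReal.ofReal_ne_top hasum).lt_top
  · have hpos : 0 ≤ (a i : ℝ) * w i := mul_nonneg (Nat.cast_nonneg _) (hw i).le
    refine le_trans ?_ (wolffPotential_mono_measure hp (Measure.le_sum _ i) x 128)
    rw [wolffPotential_smul hp ENNReal.ofReal_ne_top, mul_comm, ENNReal.ofReal_mul (by positivity),
      ENNReal.ofReal_rpow_of_nonneg hpos hq]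
    refine mul_le_mul_right ?_ _
    calc ENNReal.ofReal (1 / C) = ENNReal.ofReal (1 / C) * 1 := (mul_one _).symm
      _ ≤ ENNReal.ofReal (1 / C) * (ENNReal.ofReal C * wolffPotential p (ν i) x 128) :=
          mul_le_mul_right (hW i x hx) _
      _ = wolffPotential p (ν i) x 128 := by
          rw [← mul_assoc, ← ENNReal.ofReal_mul (by positivity), one_div_mul_cancel hC.ne',
            ENNReal.ofReal_one, one_mul]

theorem tendsto_nhdsWithin_zero_top_of_le_on_annuli {n : ℕ} {E : Set (EuclideanSpace ℝ (Fin n))}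
    (h0 : (0 : EuclideanSpace ℝ (Fin n)) ∉ E) {f : EuclideanSpace ℝ (Fin n) → ℝ≥0∞}
    {g : ℕ → ℝ} (hg : Tendsto g atTop atTop)
    (h : ∀ i, ∀ x ∈ E ∩ closedAnnulus 0 (i + 1), ENNReal.ofReal (g i) ≤ f x) :
    Tendsto f (𝓝[E] 0) (𝓝 ⊤) := by
  rw [ENNReal.tendsto_nhds_top_iff_nnreal]
  intro K
  obtain ⟨N, hN⟩ := eventually_atTop.1 (hg.eventually_gt_atTop (K : ℝ))
  have hball : Metric.ball (0 : EuclideanSpace ℝ (Fin n)) ((1 / 2) ^ (N + 1)) ∈ 𝓝[E] 0 :=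
    mem_nhdsWithin_of_mem_nhds (Metric.ball_mem_nhds _ (by positivity))
  filter_upwards [self_mem_nhdsWithin, hball] with x hxE hxb
  have hx0 : 0 < ‖x‖ := norm_pos_iff.2 fun hx => h0 (hx ▸ hxE)
  rw [mem_ball_zero_iff] at hxb
  have hx1 : ‖x‖ ≤ 1 := hxb.le.trans (pow_le_one₀ (by norm_num) (by norm_num))
  obtain ⟨i, hi1, hi2⟩ := exists_nat_pow_near_of_lt_one hx0 hx1 (by norm_num : (0 : ℝ) < 1 / 2)
    (by norm_num)
  have hNi : N ≤ i := by
    have h1 : (1 / 2 : ℝ) ^ (i + 1) < (1 / 2) ^ (N + 1) := hi1.trans hxb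
    have := (pow_lt_pow_iff_right_of_lt_one₀ (by norm_num) (by norm_num)).1 h1
    omega
  have hmem : x ∈ closedAnnulus (0 : EuclideanSpace ℝ (Fin n)) (i + 1) := by
    constructor
    · rw [sub_zero, zpow_neg, zpow_natCast, ← inv_pow, ← one_div]
      exact hi1.le
    · rw [sub_zero]
      have : (2 : ℝ) ^ (-((i + 1 : ℕ) : ℤ) + 1) = (1 / 2) ^ i := by
        rw [show -((i + 1 : ℕ) : ℤ) + 1 = -(i : ℤ) by push_cast; ring, zpow_neg, zpow_natCast,
          ← inv_pow, ← one_div]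
      rw [this]
      exact hi2
  refine lt_of_lt_of_le ?_ (h i x ⟨hxE, hmem⟩)
  rw [← ENNReal.ofReal_coe_nnreal]
  exact (ENNReal.ofReal_lt_ofReal_iff_of_nonneg K.2).2 (hN i hNi)

/-- A Radon measure on the neighborhood `U` of the origin is given as a regular Borel measure
on `ℝⁿ` (in particular finite on compact sets) that does not charge the complement of `U`. -/
theorem theorem5p4 {n : ℕ} (p : ℝ) (hp1 : 1 < p) (hpn : p ≤ n)
    (E : Set (EuclideanSpace ℝ (Fin n))) (hE : IsPThin p E 0)
    (h0 : (0 : EuclideanSpace ℝ (Fin n)) ∈ closure E \ E) :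
    (p < n →
      ∃ U : Set (EuclideanSpace ℝ (Fin n)), IsOpen U ∧ 0 ∈ U ∧
      ∃ μ : Measure (EuclideanSpace ℝ (Fin n)), μ.Regular ∧ μ Uᶜ = 0 ∧
      ∃ r₀ : ℝ, 0 < r₀ ∧ Metric.ball 0 (2 * r₀) ⊆ U ∧
        Tendsto (fun x => ENNReal.ofReal (‖x‖ ^ (((n : ℝ) - p) / (p - 1))) *
          wolffPotential p μ x r₀) (𝓝[E] 0) (𝓝 ⊤)) ∧
    (p = n →
      ∃ U : Set (EuclideanSpace ℝ (Fin n)), IsOpen U ∧ 0 ∈ U ∧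
      ∃ μ : Measure (EuclideanSpace ℝ (Fin n)), μ.Regular ∧ μ Uᶜ = 0 ∧
      ∃ r₀ : ℝ, 0 < r₀ ∧ Metric.ball 0 (2 * r₀) ⊆ U ∧
        Tendsto (fun x => wolffPotential p μ x r₀ /
          ENNReal.ofReal (Real.log (1 / ‖x‖))) (𝓝[E] 0) (𝓝 ⊤)) := by
  have hp0 : 0 < p - 1 := by linarith
  have hq : 0 < 1 / (p - 1) := by positivity
  have hgrow : ∀ a : ℕ → ℕ, Tendsto a atTop atTop → ∀ c : ℝ, 0 < c →
      Tendsto (fun i => c * (a i : ℝ) ^ (1 / (p - 1))) atTop atTop := fun a ha c hc =>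
    ((tendsto_rpow_atTop hq).comp (tendsto_natCast_atTop_atTop.comp ha)).const_mul_atTop hc
  have hann : ∀ (i : ℕ) (x : EuclideanSpace ℝ (Fin n)), x ∈ closedAnnulus 0 (i + 1) →
      (1 / 2 : ℝ) ^ (i + 1) ≤ ‖x‖ := by
    intro i x hx
    have := hx.1
    rwa [sub_zero, zpow_neg, zpow_natCast, ← inv_pow, ← one_div] at this
  refine ⟨fun hlt => ?_, fun heq => ?_⟩
  · obtain ⟨C, hC, hsph⟩ := exists_pCap_sphere_le n (by linarith : 0 < p)
    set r : ℕ → ℝ := fun i => (1 / 2) ^ (i + 1) with hr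
    have hr0 : ∀ i, 0 < r i := fun i => by simp only [hr]; positivity
    set w : ℕ → ℝ := fun i => (r i ^ ((n : ℝ) - p))⁻¹ with hwdef
    have hw : ∀ i, 0 < w i := fun i => inv_pos.2 (Real.rpow_pos_of_pos (hr0 i) _)
    have hsum : ∑' i, ENNReal.ofReal (w i) *
        pCap p (E ∩ closedAnnulus 0 (i + 1)) (openAnnulus 0 (i + 1)) ≠ ⊤ := by
      refine ne_top_of_le_ne_top
        (ENNReal.mul_ne_top (ENNReal.ofReal_ne_top (r := C)) (hE.1 hlt).ne) ?_
      rw [← ENNReal.tsum_mul_left]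
      refine ENNReal.tsum_le_tsum fun i => ?_
      have e1 : (2 : ℝ) ^ (-((i + 1 : ℕ) : ℤ)) = r i := by
        rw [zpow_neg, zpow_natCast, ← inv_pow, ← one_div]
      rw [zpow_add₀ (by norm_num), e1, zpow_one]
      have hpos : 0 < C * r i ^ ((n : ℝ) - p) := mul_pos hC (Real.rpow_pos_of_pos (hr0 i) _)
      calc _ = ENNReal.ofReal C *
            (pCap p (E ∩ closedAnnulus 0 (i + 1)) (openAnnulus 0 (i + 1)) /
              ENNReal.ofReal (C * r i ^ ((n : ℝ) - p))) := by
            rw [div_eq_mul_inv, ← ENNReal.ofReal_inv_of_pos hpos, mul_left_comm,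
              ← ENNReal.ofReal_mul hC.le, mul_comm]
            congr 2
            rw [mul_inv, mul_inv_cancel_left₀ hC.ne']
        _ ≤ _ := mul_le_mul_right (ENNReal.div_le_div_left (hsph (r i) (hr0 i)) _) _
    obtain ⟨μ, hμ, a, ha, c, hc, hW⟩ := exists_finiteMeasure_wolffPotential_ge hp1 hpn
      (fun i => E ∩ closedAnnulus 0 (i + 1)) w hw hsum
    -- `μ` is finite on all of `ℝⁿ`, so the whole space serves as the neighborhood
    refine ⟨univ, isOpen_univ, mem_univ _, μ, inferInstance, by simp, 128, by norm_num,
      subset_univ _, ?_⟩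
    refine tendsto_nhdsWithin_zero_top_of_le_on_annuli h0.2 (hgrow a ha c hc) fun i x hx => ?_
    have hnn : 0 ≤ ((n : ℝ) - p) / (p - 1) := div_nonneg (by linarith) hp0.le
    have hwr : r i ^ (((n : ℝ) - p) / (p - 1)) * w i ^ (1 / (p - 1)) = 1 := by
      have h1 : r i ^ (((n : ℝ) - p) / (p - 1)) = (r i ^ ((n : ℝ) - p)) ^ (1 / (p - 1)) := by
        rw [← Real.rpow_mul (hr0 i).le, mul_one_div]
      have h2 := Real.rpow_pos_of_pos (hr0 i) ((n : ℝ) - p)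
      rw [h1, ← Real.mul_rpow h2.le (hw i).le, hwdef]
      simp only
      rw [mul_inv_cancel₀ h2.ne', Real.one_rpow]
    calc ENNReal.ofReal (c * (a i : ℝ) ^ (1 / (p - 1)))
        = ENNReal.ofReal (r i ^ (((n : ℝ) - p) / (p - 1))) *
            ENNReal.ofReal (c * (a i * w i) ^ (1 / (p - 1))) := by
          rw [← ENNReal.ofReal_mul (Real.rpow_nonneg (hr0 i).le _)]
          congr 1
          rw [Real.mul_rpow (Nat.cast_nonneg _) (hw i).le]
          linear_combination -(c * (a i : ℝ) ^ (1 / (p - 1))) * hwr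
      _ ≤ _ := mul_le_mul' (ENNReal.ofReal_le_ofReal
          (Real.rpow_le_rpow (hr0 i).le (hann i x hx.2) hnn)) (hW i x hx)
  · set w : ℕ → ℝ := fun i => ((i + 1 : ℕ) : ℝ) ^ ((n : ℝ) - 1) with hwdef
    have hw : ∀ i, 0 < w i := fun i => Real.rpow_pos_of_pos (by positivity) _
    have hsum : ∑' i, ENNReal.ofReal (w i) *
        pCap p (E ∩ closedAnnulus 0 (i + 1)) (openAnnulus 0 (i + 1)) ≠ ⊤ := by
      refine ne_top_of_le_ne_top (hE.2 heq).ne (le_of_eq (tsum_congr fun i => ?_))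
      rw [hwdef, ← ENNReal.ofReal_rpow_of_pos (by positivity), ENNReal.ofReal_natCast]
    obtain ⟨μ, hμ, a, ha, c, hc, hW⟩ := exists_finiteMeasure_wolffPotential_ge hp1 hpn
      (fun i => E ∩ closedAnnulus 0 (i + 1)) w hw hsum
    refine ⟨univ, isOpen_univ, mem_univ _, μ, inferInstance, by simp, 128, by norm_num,
      subset_univ _, ?_⟩
    have hlog2 : 0 < Real.log 2 := Real.log_pos (by norm_num)
    refine tendsto_nhdsWithin_zero_top_of_le_on_annuli h0.2
      (hgrow a ha (c / Real.log 2) (by positivity)) fun i x hx => ?_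
    have hi0 : (0 : ℝ) < ((i + 1 : ℕ) : ℝ) := by positivity
    have hwi : w i ^ (1 / (p - 1)) = ((i + 1 : ℕ) : ℝ) := by
      rw [hwdef, ← heq]
      simp only
      rw [← Real.rpow_mul hi0.le, mul_one_div_cancel hp0.ne', Real.rpow_one]
    have hlog : Real.log (1 / ‖x‖) ≤ ((i + 1 : ℕ) : ℝ) * Real.log 2 := by
      have h1 := Real.log_le_log (by positivity) (hann i x hx.2)
      rw [Real.log_pow, one_div, Real.log_inv] at h1
      rw [one_div, Real.log_inv]
      linarith
    calc ENNReal.ofReal (c / Real.log 2 * (a i : ℝ) ^ (1 / (p - 1)))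
        = ENNReal.ofReal (c * (a i * w i) ^ (1 / (p - 1))) /
            ENNReal.ofReal (((i + 1 : ℕ) : ℝ) * Real.log 2) := by
          rw [← ENNReal.ofReal_div_of_pos (by positivity)]
          congr 1
          rw [Real.mul_rpow (Nat.cast_nonneg _) (hw i).le, hwi]
          field_simp
      _ ≤ _ := ENNReal.div_le_div (hW i x hx) (ENNReal.ofReal_le_ofReal hlog)
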